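/- For positive integers $m,n$, let $\mathcal{P}(m,n)\subseteq\mathbb{R}^m$ be the partial permutohedron, i.e. the convex hull of all vectors in $\{0,1,\ldots,n\}^m$ whose nonzero entries are distinct. For a $d$-dimensional polytope $P$, let $f_i(P)$ be the number of $i$-dimensional faces of $P$ ($0\le i\le d$; the polytope $P$ itself is counted as a face), let $f_P(t)=\sum_{i=0}^{d}f_i(P)\,t^i$, and let $h_P(t)=f_P(t-1)$ be the $h$-polynomial of $P$. Let $A_0(t)=1$ and, for $k\ge1$, let $A_k(t)=\sum_{i=0}^{k-1}A(k,i)\,t^i$ be the Eulerian polynomial, where $A(k,i)$ is the number of permutations of $\{1,\ldots,k\}$ with exactly $i$ descents. Sums whose upper limit is smaller than the lower limit are empty. **Theorem.** For all positive integers $m$ and $n$, $$h_{\mathcal{P}(m,n)}(t)=1+\sum_{i=0}^{n-1}\;\sum_{j=1}^{m-i}\binom{m}{i}\,A_i(t)\,t^j.\qquad(1)$$ Equivalently, for every positive integer $m$, $$h_{\mathcal{P}(m,1)}(t)=\sum_{i=0}^{m}t^i\qquad\text{and}\qquad h_{\mathcal{P}(m,n+1)}(t)=h_{\mathcal{P}(m,n)}(t)+\binom{m}{n}\,A_n(t)\sum_{i=1}^{m-n}t^i\quad\text{for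 all } n\ge1.\qquad(2)$$ Here "equivalently" means that, for each fixed $m\ge1$, a sequence of polynomials $(H_n)_{n\ge1}$ in $\mathbb{Z}[t]$ satisfies (1) for all $n\ge1$ (with $H_n$ in place of $h_{\mathcal{P}(m,n)}$) if and only if it satisfies (2) (with the same replacement). -/

import Mathlib

open Polynomial

namespace PartialPermutohedron

/-- The partial permutohedron `𝒫(m,n)`: the convex hull in `ℝ^m` of all vectors with entries in
`{0,1,…,n}` whose nonzero entries are distinct. -/
def partialPermutohedron (m n : ℕ) : Set (Fin m → ℝ) :=
  convexHull ℝ {x | ∃ w : Fin m → ℕ, (∀ i, w i ≤ n) ∧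
    (∀ i j, w i ≠ 0 → w i = w j → i = j) ∧ ∀ i, x i = (w i : ℝ)}

/-- `F` is a face of `P`: the intersection of `P` with the hyperplane `⟨a,x⟩ = b` for some linear
inequality `⟨a,x⟩ ≥ b` which is valid on `P` (here `a` may be zero, so `∅` and `P` are faces). -/
def IsFace {m : ℕ} (P F : Set (Fin m → ℝ)) : Prop :=
  ∃ (a : Fin m → ℝ) (b : ℝ), (∀ x ∈ P, b ≤ dotProduct a x) ∧ F = {x ∈ P | dotProduct a x = b}

/-- The dimension of the affine hull of a set; used for nonempty sets only. -/
noncomputable def dimension {m : ℕ} (P : Set (Fin m → ℝ)) : ℕ :=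
  Module.finrank ℝ (vectorSpan ℝ P)

/-- `f_i(P)`, the number of `i`-dimensional faces of `P`. The empty face has dimension `-1`, and so
is not counted for any natural number `i`. -/
noncomputable def faceCount {m : ℕ} (P : Set (Fin m → ℝ)) (i : ℕ) : ℕ :=
  Set.ncard {F | IsFace P F ∧ F.Nonempty ∧ dimension F = i}

/-- The `f`-polynomial `∑_{i=0}^{dim P} f_i(P) t^i`. -/
noncomputable def fPolynomial {m : ℕ} (P : Set (Fin m → ℝ)) : ℤ[X] :=
  ∑ i ∈ Finset.range (dimension P + 1), C (faceCount P i : ℤ) * X ^ i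

/-- The `h`-polynomial `h_P(t) = f_P(t-1)`. -/
noncomputable def hPolynomial {m : ℕ} (P : Set (Fin m → ℝ)) : ℤ[X] :=
  (fPolynomial P).comp (X - 1)

/-- The number of descents of `σ`, i.e. of positions `i` with `σ(i) > σ(i+1)`. -/
def descentCount {m : ℕ} (σ : Equiv.Perm (Fin m)) : ℕ :=
  (Finset.univ.filter fun i : Fin m => ∃ j : Fin m, (j : ℕ) = (i : ℕ) + 1 ∧ σ j < σ i).card

/-- The Eulerian number `A(m,i)`: the number of permutations in `𝔖_m` with exactly `i` descents. -/
def eulerianNumber (m i : ℕ) : ℕ :=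
  (Finset.univ.filter fun σ : Equiv.Perm (Fin m) => descentCount σ = i).card

/-- The Eulerian polynomial: `A_0(t) = 1` and `A_m(t) = ∑_{i=0}^{m-1} A(m,i) t^i` for `m ≥ 1`. -/
noncomputable def eulerianPolynomial (m : ℕ) : ℤ[X] :=
  if m = 0 then 1 else ∑ i ∈ Finset.range m, C (eulerianNumber m i : ℤ) * X ^ i

end PartialPermutohedron

namespace PartialPermutohedron

/-! ### Chains of sets with prescribed union -/

section Chains

variable {α : Type*}

/-! The nonempty faces of the partial permutohedron are encoded by pairs `(T, C)`: a set `T` of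
coordinates and a chain `C` of nonempty subsets of `T` whose members other than `T` have fewer than
`n` elements. On the face, coordinates off `T` vanish and the valid inequality `∑_{i ∈ S} x_i ≤ n +
(n-1) + ⋯` (`|S|` terms, cut off at zero) is tight for each `S ∈ C`; the dimension is `|T| - |C|`.
Every nonempty face arises this way, because the negative part of a linear functional is a positive
combination of indicators of a chain (`functional_faceOf`, `exists_chain_decomposition`). The size
condition removes redundancy: beyond `n` elements the bound stops growing
(`exists_faceChains_faceOf_eq`). Vertices given by rankings show that `T`, `C` and the dimension can
be read off the face (`faceOf_injective`, `dimension_faceOf_add_card`).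

Hence `h(t) = ∑ (t-1)^(|T|-|C|)` over all pairs. The empty `T` gives `1`. For nonempty `T`, let `I`
be the union of the members of `C` other than `T`, so `|I| < n`. The choice whether `T ∈ C` gives
the factor `(t-1)^(|T|-|I|-1) (1 + (t-1))`, that is, `t (t-1)^(|T|-|I|-1)`. The chains with union
`I` sum to the Eulerian polynomial of `|I|`: writing each block of an ordered set partition in
decreasing order gives a permutation with a marked set `D` of descents (those inside blocks), and
`∑_{D ⊆ Des σ} (t-1)^|D| = t^(des σ)`. Summing over `T ⊋ I` by the binomial theorem yields `t + ⋯ +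
t^(m-|I|)`, and there are `m.choose i` sets `I` of size `i`. -/

theorem exists_forall_subset_of_isChain {C : Finset (Finset α)}
    (hC : IsChain (· ⊆ ·) (C : Set (Finset α))) (hne : C.Nonempty) :
    ∃ S ∈ C, ∀ S' ∈ C, S' ⊆ S := by
  obtain ⟨S, hS, hmax⟩ := C.exists_max_image Finset.card hne
  refine ⟨S, hS, fun S' hS' => ?_⟩
  rcases hC.total hS hS' with h | h
  · exact (Finset.eq_of_subset_of_card_le h (hmax S' hS')).ge
  · exact h

variable [DecidableEq α]

theorem sup_mem_of_isChain {C : Finset (Finset α)}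
    (hC : IsChain (· ⊆ ·) (C : Set (Finset α))) (hne : C.Nonempty) : C.sup id ∈ C := by
  obtain ⟨S, hS, h⟩ := exists_forall_subset_of_isChain hC hne
  have : C.sup id = S := le_antisymm (Finset.sup_le h) (Finset.le_sup (f := id) hS)
  rwa [this]

variable [Fintype α]

open Classical in
/-- The chains of nonempty sets whose union is `I`. -/
noncomputable def chainsWithTop (I : Finset α) : Finset (Finset (Finset α)) :=
  Finset.univ.filter fun C => IsChain (· ⊆ ·) (C : Set (Finset α)) ∧ ∅ ∉ C ∧ C.sup id = I

theorem mem_chainsWithTop {I : Finset α} {C : Finset (Finset α)} :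
    C ∈ chainsWithTop I ↔ IsChain (· ⊆ ·) (C : Set (Finset α)) ∧ ∅ ∉ C ∧ C.sup id = I := by
  simp [chainsWithTop]

theorem subset_of_mem_chainsWithTop {I S : Finset α} {C : Finset (Finset α)}
    (hC : C ∈ chainsWithTop I) (hS : S ∈ C) : S ⊆ I :=
  (mem_chainsWithTop.1 hC).2.2 ▸ Finset.le_sup (f := id) hS

theorem card_le_of_mem_chainsWithTop {I : Finset α} {C : Finset (Finset α)}
    (hC : C ∈ chainsWithTop I) : C.card ≤ I.card := by
  have hsub := fun S => subset_of_mem_chainsWithTop (S := S) hC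
  obtain ⟨hc, h0, -⟩ := mem_chainsWithTop.1 hC
  calc C.card ≤ (Finset.Icc 1 I.card).card := by
        refine Finset.card_le_card_of_injOn Finset.card (fun S hS => ?_) (fun S hS S' hS' h => ?_)
        · have hS := Finset.mem_coe.1 hS
          rw [Finset.mem_coe, Finset.mem_Icc]
          refine ⟨Finset.card_pos.2 (Finset.nonempty_iff_ne_empty.2 ?_),
            Finset.card_le_card (hsub S hS)⟩
          rintro rfl
          exact h0 hS
        · rcases hc.total hS hS' with h' | h'
          · exact Finset.eq_of_subset_of_card_le h' h.ge
          · exact (Finset.eq_of_subset_of_card_le h' h.le).symm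
    _ = I.card := by simp

theorem chainsWithTop_empty : chainsWithTop (∅ : Finset α) = {∅} := by
  ext C
  rw [mem_chainsWithTop, Finset.mem_singleton]
  constructor
  · rintro ⟨-, h0, hs⟩
    refine Finset.eq_empty_of_forall_notMem fun S hS => h0 ?_
    have : S ⊆ ∅ := hs ▸ Finset.le_sup (f := id) hS
    rwa [Finset.subset_empty.1 this] at hS
  · rintro rfl
    simp

/-- Removing the top member of a chain. -/
theorem sum_chains_mem_top {M : Type*} [AddCommMonoid M] (p : Finset α → Prop) [DecidablePred p]
    {T : Finset α} (hT : T.Nonempty) (hp : ∀ S S', S ⊆ S' → p S' → p S)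
    (g : Finset (Finset α) → M) :
    ∑ C ∈ (chainsWithTop T).filter (fun C => ∀ S ∈ C, S = T ∨ p S), g C =
      ∑ I ∈ T.ssubsets.filter (fun I => p I ∨ I = ∅), ∑ C ∈ chainsWithTop I, g (insert T C) := by
  rw [Finset.sum_sigma']
  symm
  refine Finset.sum_bij (fun x _ => insert T x.2) ?_ ?_ ?_ ?_
  · rintro ⟨I, C⟩ h
    simp only [Finset.mem_sigma, Finset.mem_filter, Finset.mem_ssubsets] at h
    obtain ⟨⟨hIT, hI⟩, hC⟩ := h
    have hsub := fun S => subset_of_mem_chainsWithTop (S := S) hC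
    obtain ⟨hc, h0, hs⟩ := mem_chainsWithTop.1 hC
    rw [Finset.mem_filter, mem_chainsWithTop]
    refine ⟨⟨?_, ?_, ?_⟩, ?_⟩
    · rw [Finset.coe_insert]
      exact hc.insert fun S hS _ => Or.inr ((hsub S hS).trans hIT.1)
    · rw [Finset.mem_insert, not_or]
      exact ⟨hT.ne_empty.symm, h0⟩
    · rw [Finset.sup_insert, hs]
      exact sup_eq_left.2 hIT.1
    · intro S hS
      rcases Finset.mem_insert.1 hS with h | h
      · exact Or.inl h
      · right
        rcases hI with hI | rfl
        · exact hp _ _ (hsub S h) hI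
        · rw [Finset.subset_empty.1 (hsub S h)] at h
          exact absurd h h0
  · rintro ⟨I, C⟩ h ⟨I', C'⟩ h' heq
    simp only [Finset.mem_sigma, Finset.mem_filter, Finset.mem_ssubsets] at h h' heq
    have key : ∀ {I C}, I ⊂ T → C ∈ chainsWithTop I → T ∉ C := fun hI hC hTC =>
      hI.2 (subset_of_mem_chainsWithTop hC hTC)
    have : C = C' := by
      rw [← Finset.erase_insert (key h.1.1 h.2), heq, Finset.erase_insert (key h'.1.1 h'.2)]
    subst this
    have : I = I' := (mem_chainsWithTop.1 h.2).2.2.symm.trans (mem_chainsWithTop.1 h'.2).2.2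
    subst this
    rfl
  · intro C hC
    rw [Finset.mem_filter] at hC
    obtain ⟨hC, hpC⟩ := hC
    have hsub := fun S => subset_of_mem_chainsWithTop (S := S) hC
    obtain ⟨hc, h0, hs⟩ := mem_chainsWithTop.1 hC
    have hne : C.Nonempty := by
      rw [Finset.nonempty_iff_ne_empty]
      rintro rfl
      exact hT.ne_empty (by simpa using hs.symm)
    have hTC : T ∈ C := hs ▸ sup_mem_of_isChain hc hne
    have hce : IsChain (· ⊆ ·) ((C.erase T : Finset (Finset α)) : Set (Finset α)) :=
      hc.mono (Finset.coe_subset.2 (Finset.erase_subset _ _))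
    refine ⟨⟨(C.erase T).sup id, C.erase T⟩, ?_, Finset.insert_erase hTC⟩
    rw [Finset.mem_sigma, Finset.mem_filter, Finset.mem_ssubsets, mem_chainsWithTop]
    -- The chain `{T}` corresponds to `I = ∅`, for which `p` may fail; this is why `I = ∅` is
    -- allowed separately.
    rcases (C.erase T).eq_empty_or_nonempty with he | he
    · simp [he, Finset.ssubset_iff_subset_ne, hT.ne_empty.symm]
    · have hm := sup_mem_of_isChain hce he
      obtain ⟨h1, h2⟩ := Finset.mem_erase.1 hm
      refine ⟨⟨lt_of_le_of_ne (hsub _ h2) h1, Or.inl ?_⟩, hce, fun h => h0 (Finset.mem_of_mem_erase h),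
        rfl⟩
      exact (hpC _ h2).resolve_left h1
  · intros
    rfl

/-- The `f`-polynomial of a permutohedron, evaluated at `X - 1`: ordered set partitions of `I`
counted by `I.card` minus the number of blocks. -/
noncomputable def chainPolynomial (I : Finset α) : ℤ[X] :=
  ∑ C ∈ chainsWithTop I, (X - 1) ^ (I.card - C.card)

theorem card_insert_of_mem_chainsWithTop {I T : Finset α} {C : Finset (Finset α)} (hI : I ⊂ T)
    (hC : C ∈ chainsWithTop I) : (insert T C).card = C.card + 1 :=
  Finset.card_insert_of_notMem fun hTC => hI.2 (subset_of_mem_chainsWithTop hC hTC)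

theorem chainPolynomial_eq_sum {T : Finset α} (hT : T.Nonempty) :
    chainPolynomial T =
      ∑ I ∈ T.ssubsets, (X - 1) ^ (T.card - I.card - 1) * chainPolynomial I := by
  have h := sum_chains_mem_top (fun _ => True) hT (fun _ _ _ h => h)
    (fun C => (X - 1 : ℤ[X]) ^ (T.card - C.card))
  simp only [or_true, imp_true_iff, Finset.filter_true, true_or] at h
  rw [chainPolynomial, h]
  refine Finset.sum_congr rfl fun I hI => ?_
  rw [chainPolynomial, Finset.mul_sum]
  refine Finset.sum_congr rfl fun C hC => ?_
  have hI := Finset.mem_ssubsets.1 hI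
  have h1 := card_le_of_mem_chainsWithTop hC
  have h2 := Finset.card_lt_card hI
  rw [card_insert_of_mem_chainsWithTop hI hC, ← pow_add]
  congr 1
  omega

end Chains

theorem sum_ssubsets_apply_card {α : Type*} [DecidableEq α] {M : Type*} [AddCommMonoid M]
    (T : Finset α) (g : ℕ → M) :
    ∑ I ∈ T.ssubsets, g I.card = ∑ j ∈ Finset.range T.card, T.card.choose j • g j := by
  have h : ∀ I ∈ T.ssubsets, I.card ∈ Finset.range T.card := fun I hI =>
    Finset.mem_range.2 (Finset.card_lt_card (Finset.mem_ssubsets.1 hI))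
  rw [← Finset.sum_fiberwise_of_maps_to h]
  refine Finset.sum_congr rfl fun j hj => ?_
  rw [Finset.sum_congr rfl (g := fun _ => g j)
    (fun I hI => by rw [(Finset.mem_filter.1 hI).2]), Finset.sum_const]
  congr 1
  rw [← Finset.card_powersetCard]
  congr 1
  ext I
  simp only [Finset.mem_filter, Finset.mem_ssubsets, Finset.mem_powersetCard]
  refine and_congr_left fun hI => ⟨fun h => h.1, fun h => Finset.ssubset_iff_subset_ne.2 ⟨h, ?_⟩⟩
  rintro rfl
  exact (Finset.mem_range.1 hj).ne hI.symm

/-- The recursion over proper subsets sees only cardinalities, so strong induction applies. This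
transfers the count on `Fin k` to an arbitrary set of `k` elements. -/
theorem chainPolynomial_eq_of_card_eq {α β : Type*} [DecidableEq α] [Fintype α] [DecidableEq β]
    [Fintype β] : ∀ (k : ℕ) (I : Finset α) (J : Finset β), I.card = k → J.card = k →
      chainPolynomial I = chainPolynomial J := by
  intro k
  induction k using Nat.strong_induction_on with
  | _ k ih =>
    intro I J hI hJ
    rcases Nat.eq_zero_or_pos k with rfl | hk
    · rw [Finset.card_eq_zero] at hI hJ
      subst hI hJ
      simp [chainPolynomial, chainsWithTop_empty]
    · rw [chainPolynomial_eq_sum (Finset.card_pos.1 (hI ▸ hk)),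
        chainPolynomial_eq_sum (Finset.card_pos.1 (hJ ▸ hk))]
      have hα : ∃ g : ℕ → ℤ[X], (∀ I' ∈ I.ssubsets, chainPolynomial I' = g I'.card) ∧
          ∀ J' ∈ J.ssubsets, chainPolynomial J' = g J'.card := by
        classical
        -- The common value at size `j` is read off an arbitrary representative; the induction
        -- hypothesis makes the choice irrelevant.
        refine ⟨fun j => if h : ∃ J' : Finset β, J' ⊂ J ∧ J'.card = j then
          chainPolynomial h.choose else 0, fun I' hI' => ?_, fun J' hJ' => ?_⟩
        · have hlt : I'.card < k := hI ▸ Finset.card_lt_card (Finset.mem_ssubsets.1 hI')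
          obtain ⟨J', hJ', hc⟩ := Finset.exists_subset_card_eq (hJ ▸ hlt.le : I'.card ≤ J.card)
          have h : ∃ J' : Finset β, J' ⊂ J ∧ J'.card = I'.card := by
            refine ⟨J', Finset.ssubset_iff_subset_ne.2 ⟨hJ', ?_⟩, hc⟩
            rintro rfl
            omega
          simp only [dif_pos h]
          exact ih _ hlt _ _ rfl h.choose_spec.2
        · have hlt : J'.card < k := hJ ▸ Finset.card_lt_card (Finset.mem_ssubsets.1 hJ')
          have h : ∃ J'' : Finset β, J'' ⊂ J ∧ J''.card = J'.card :=
            ⟨J', Finset.mem_ssubsets.1 hJ', rfl⟩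
          simp only [dif_pos h]
          obtain ⟨I', hI', hc⟩ := Finset.exists_subset_card_eq (hI ▸ hlt.le : J'.card ≤ I.card)
          rw [← ih _ hlt I' J' hc rfl]
          exact ih _ hlt I' _ hc h.choose_spec.2
      obtain ⟨g, hg1, hg2⟩ := hα
      have e1 := sum_ssubsets_apply_card I fun j => (X - 1) ^ (k - j - 1) * g j
      have e2 := sum_ssubsets_apply_card J fun j => (X - 1) ^ (k - j - 1) * g j
      rw [hI] at e1 ⊢
      rw [hJ] at e2 ⊢
      rw [← e1] at e2
      refine (Finset.sum_congr rfl fun I' hI' => ?_).trans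
        (e2.symm.trans (Finset.sum_congr rfl fun J' hJ' => ?_))
      · rw [hg1 I' hI']
      · rw [hg2 J' hJ']

/-! ### Ordered set partitions and descents -/

section Eulerian

variable {k : ℕ}

/-- The positions of the descents of `σ`. -/
def descentSet (σ : Equiv.Perm (Fin k)) : Finset (Fin k) :=
  Finset.univ.filter fun i : Fin k => ∃ j : Fin k, (j : ℕ) = (i : ℕ) + 1 ∧ σ j < σ i

/-- The set of the first `j + 1` values of `σ`. -/
def prefixSet (σ : Equiv.Perm (Fin k)) (j : Fin k) : Finset (Fin k) :=
  (Finset.Iic j).map σ.toEmbedding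

theorem apply_mem_prefixSet {σ : Equiv.Perm (Fin k)} {i j : Fin k} :
    σ i ∈ prefixSet σ j ↔ i ≤ j := by
  simp [prefixSet]

theorem card_prefixSet (σ : Equiv.Perm (Fin k)) (j : Fin k) :
    (prefixSet σ j).card = j + 1 := by
  simp [prefixSet]

theorem prefixSet_injective (σ : Equiv.Perm (Fin k)) : Function.Injective (prefixSet σ) := by
  intro i j h
  have := congrArg Finset.card h
  rw [card_prefixSet, card_prefixSet] at this
  exact Fin.ext (by omega)

/-- The chain of those prefixes of `σ` that do not end in `D`. -/
def prefixChain (σ : Equiv.Perm (Fin k)) (D : Finset (Fin k)) : Finset (Finset (Fin k)) :=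
  Dᶜ.map ⟨prefixSet σ, prefixSet_injective σ⟩

theorem mem_prefixChain {σ : Equiv.Perm (Fin k)} {D S : Finset (Fin k)} :
    S ∈ prefixChain σ D ↔ ∃ j, j ∉ D ∧ prefixSet σ j = S := by
  simp [prefixChain]

theorem card_prefixChain (σ : Equiv.Perm (Fin k)) (D : Finset (Fin k)) :
    (prefixChain σ D).card = k - D.card := by
  simp [prefixChain, Finset.card_compl]

theorem prefixChain_mem_chainsWithTop {σ : Equiv.Perm (Fin k)} {D : Finset (Fin k)}
    (hD : D ⊆ descentSet σ) : prefixChain σ D ∈ chainsWithTop Finset.univ := by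
  rw [mem_chainsWithTop]
  refine ⟨?_, ?_, ?_⟩
  · intro S hS S' hS' _
    obtain ⟨i, -, rfl⟩ := mem_prefixChain.1 (Finset.mem_coe.1 hS)
    obtain ⟨j, -, rfl⟩ := mem_prefixChain.1 (Finset.mem_coe.1 hS')
    have key : ∀ i j : Fin k, i ≤ j → prefixSet σ i ⊆ prefixSet σ j := fun i j h =>
      Finset.map_subset_map.2 (Finset.Iic_subset_Iic.2 h)
    exact (le_total i j).imp (key i j) (key j i)
  · rw [mem_prefixChain]
    rintro ⟨j, -, h⟩
    have := card_prefixSet σ j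
    rw [h] at this
    simp at this
  · refine Finset.eq_univ_of_forall fun a => ?_
    have hk : 0 < k := a.pos
    -- The last position is never a descent, so the full set always survives as a prefix.
    have hlast : (⟨k - 1, by omega⟩ : Fin k) ∉ D := by
      intro h
      obtain ⟨j, hj, -⟩ := (Finset.mem_filter.1 (hD h)).2
      have := j.2
      simp only at hj
      omega
    refine Finset.le_sup (f := id) (mem_prefixChain.2 ⟨_, hlast, rfl⟩) ?_
    obtain ⟨i, rfl⟩ := σ.surjective a
    simp only [id, apply_mem_prefixSet, Fin.le_def]
    omega

/-- The order relation on the values which sorts by a chain first and decreasingly within blocks. -/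
def SeparatedBy (C : Finset (Finset (Fin k))) (a b : Fin k) : Prop :=
  (∃ S ∈ C, a ∈ S ∧ b ∉ S) ∨ ((∀ S ∈ C, a ∈ S ↔ b ∈ S) ∧ b < a)

theorem SeparatedBy.asymm {C : Finset (Finset (Fin k))}
    (hC : IsChain (· ⊆ ·) (C : Set (Finset (Fin k)))) {a b : Fin k} (h : SeparatedBy C a b) :
    ¬ SeparatedBy C b a := by
  rintro (⟨S', hS', hb', ha'⟩ | ⟨he', hlt'⟩) <;> rcases h with ⟨S, hS, ha, hb⟩ | ⟨he, hlt⟩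
  · rcases hC.total hS hS' with h | h
    · exact ha' (h ha)
    · exact hb (h hb')
  · exact ha' ((he S' hS').2 hb')
  · exact hb ((he' S hS).2 ha)
  · exact lt_asymm hlt hlt'

/-- The order in which `σ` lists the values depends on the chain alone; this is what makes `σ`
recoverable from it. -/
theorem separatedBy_prefixChain {σ : Equiv.Perm (Fin k)} {D : Finset (Fin k)}
    (hD : D ⊆ descentSet σ) {p q : Fin k} (hpq : p < q) :
    SeparatedBy (prefixChain σ D) (σ p) (σ q) := by
  by_cases h : ∃ j, j ∉ D ∧ p ≤ j ∧ j < q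
  · obtain ⟨j, hj, h1, h2⟩ := h
    exact Or.inl ⟨_, mem_prefixChain.2 ⟨j, hj, rfl⟩, apply_mem_prefixSet.2 h1,
      fun h => not_le.2 h2 (apply_mem_prefixSet.1 h)⟩
  · push Not at h
    refine Or.inr ⟨fun S hS => ?_, ?_⟩
    · obtain ⟨j, hj, rfl⟩ := mem_prefixChain.1 hS
      rw [apply_mem_prefixSet, apply_mem_prefixSet]
      exact ⟨fun h' => h j hj h', fun h' => hpq.le.trans h'⟩
    -- No kept prefix ends between `p` and `q`, so all positions from `p` up to `q - 1` lie in `D`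
    -- and are descents: the values decrease from `p` to `q`.
    · have key : ∀ d : ℕ, ∀ r : Fin k, (r : ℕ) = p + d + 1 → r ≤ q → σ r < σ p := by
        intro d
        induction d with
        | zero =>
          intro r hr hrq
          have hp : p ∈ D := by
            by_contra hp
            exact absurd (h p hp le_rfl) (not_le.2 hpq)
          obtain ⟨j, hj, hlt⟩ := (Finset.mem_filter.1 (hD hp)).2
          rwa [show r = j from Fin.ext (by omega)]
        | succ d ih =>
          intro r hr hrq
          have hs : (p : ℕ) + d + 1 < k := by have := r.2; omega
          have hsr : (⟨p + d + 1, hs⟩ : Fin k) < q := by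
            rw [Fin.le_def] at hrq
            rw [Fin.lt_def]
            simp only
            omega
          have hsD : (⟨p + d + 1, hs⟩ : Fin k) ∈ D := by
            by_contra hp
            refine absurd (h _ hp ?_) (not_le.2 hsr)
            rw [Fin.le_def]
            simp only
            omega
          obtain ⟨j, hj, hlt⟩ := (Finset.mem_filter.1 (hD hsD)).2
          rw [show r = j from Fin.ext (by simp only at hj; omega)]
          exact hlt.trans (ih _ rfl hsr.le)
      exact key (q - p - 1) q (by rw [Fin.lt_def] at hpq; omega) le_rfl

theorem prefixChain_injective {σ σ' : Equiv.Perm (Fin k)} {D D' : Finset (Fin k)}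
    (hD : D ⊆ descentSet σ) (hD' : D' ⊆ descentSet σ')
    (h : prefixChain σ D = prefixChain σ' D') : σ = σ' ∧ D = D' := by
  constructor
  -- A strictly increasing self-map of `Fin k` is the identity, so it suffices that both
  -- permutations list the values in the same order.
  · have hmono : StrictMono (fun p => σ'.symm (σ p)) := by
      intro p q hpq
      rcases lt_trichotomy (σ'.symm (σ p)) (σ'.symm (σ q)) with h' | h' | h'
      · exact h'
      · exact absurd (σ.injective (σ'.symm.injective h')) hpq.ne
      · have h1 := separatedBy_prefixChain hD hpq
        have h2 := separatedBy_prefixChain hD' h'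
        rw [Equiv.apply_symm_apply, Equiv.apply_symm_apply, ← h] at h2
        exact absurd h2
          (h1.asymm (mem_chainsWithTop.1 (prefixChain_mem_chainsWithTop hD)).1)
    have hid := hmono.eq_id
    ext1 p
    have := congrFun hid p
    simp only [id] at this
    rw [← this, Equiv.apply_symm_apply, this]
  · have key : ∀ (σ : Equiv.Perm (Fin k)) (D : Finset (Fin k)) (j : Fin k),
        j ∉ D ↔ ∃ S ∈ prefixChain σ D, S.card = j + 1 := by
      intro σ D j
      constructor
      · exact fun hj => ⟨_, mem_prefixChain.2 ⟨j, hj, rfl⟩, card_prefixSet σ j⟩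
      · rintro ⟨S, hS, hc⟩
        obtain ⟨i, hi, rfl⟩ := mem_prefixChain.1 hS
        rw [card_prefixSet] at hc
        rwa [show j = i from Fin.ext (by omega)]
    ext j
    exact not_iff_not.1 ((key σ D j).trans (by rw [h]; exact (key σ' D' j).symm))

/-- List the blocks in chain order, each decreasingly: members of the chain become prefixes, and any
prefix not in the chain ends inside a block, hence at a descent. -/
theorem exists_prefixChain_eq {C : Finset (Finset (Fin k))}
    (hC : C ∈ chainsWithTop Finset.univ) :
    ∃ (σ : Equiv.Perm (Fin k)) (D : Finset (Fin k)), D ⊆ descentSet σ ∧ prefixChain σ D = C := by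
  obtain ⟨hc, h0, hs⟩ := mem_chainsWithTop.1 hC
  -- The number of members missing `a` is the index of the block of `a`; `key` orders by block and
  -- then, through the dual order, decreasingly.
  let cnt : Fin k → ℕ := fun a => (C.filter (a ∉ ·)).card
  have hcnt : ∀ {S a b}, S ∈ C → a ∈ S → b ∉ S → cnt a < cnt b := by
    intro S a b hS ha hb
    refine Finset.card_lt_card (Finset.ssubset_iff_subset_ne.2 ⟨fun S' hS' => ?_, fun he => ?_⟩)
    · rw [Finset.mem_filter] at hS' ⊢
      refine ⟨hS'.1, fun hb' => ?_⟩
      rcases hc.total hS hS'.1 with h | h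
      · exact hS'.2 (h ha)
      · exact hb (h hb')
    · have : S ∈ C.filter (a ∉ ·) := he ▸ Finset.mem_filter.2 ⟨hS, hb⟩
      exact (Finset.mem_filter.1 this).2 ha
  let key : Fin k → ℕ ×ₗ (Fin k)ᵒᵈ := fun a => toLex (cnt a, OrderDual.toDual a)
  let σ := Tuple.sort key
  have hinj : Function.Injective key := fun a b h => by
    have := congrArg (fun x => OrderDual.ofDual (ofLex x).2) h
    exact this
  have hmono : StrictMono (key ∘ σ) :=
    (Tuple.monotone_sort key).strictMono_of_injective (hinj.comp σ.injective)
  have hinit : ∀ S ∈ C, ∀ p q, σ p ∈ S → q ≤ p → σ q ∈ S := by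
    intro S hS p q hp hqp
    by_contra hq
    have h1 := hcnt hS hp hq
    have h2 := hmono.monotone hqp
    have h3 : key (σ p) < key (σ q) := Prod.Lex.lt_iff.2 (Or.inl h1)
    exact not_le.2 h3 h2
  have hpre : ∀ S ∈ C, ∃ j, prefixSet σ j = S := by
    intro S hS
    have hne : S.Nonempty := by
      rw [Finset.nonempty_iff_ne_empty]
      rintro rfl
      exact h0 hS
    obtain ⟨p, hp, hmax⟩ := (S.map σ.symm.toEmbedding).exists_max_image id (hne.map)
    refine ⟨p, Finset.ext fun a => ?_⟩
    obtain ⟨q, rfl⟩ := σ.surjective a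
    have hp' : σ p ∈ S := by simpa using hp
    rw [apply_mem_prefixSet]
    refine ⟨fun h => hinit S hS p q hp' h, fun h => hmax q ?_⟩
    simpa using h
  refine ⟨σ, Finset.univ.filter fun j => prefixSet σ j ∉ C, fun j hj => ?_, ?_⟩
  · have hj := (Finset.mem_filter.1 hj).2
    rw [descentSet, Finset.mem_filter]
    refine ⟨Finset.mem_univ _, ?_⟩
    have hlt : (j : ℕ) + 1 < k := by
      by_contra hlt
      apply hj
      have : prefixSet σ j = Finset.univ := by
        refine Finset.eq_univ_of_forall fun a => ?_
        obtain ⟨q, rfl⟩ := σ.surjective a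
        rw [apply_mem_prefixSet, Fin.le_def]
        omega
      rw [this, ← hs]
      refine sup_mem_of_isChain hc ?_
      rw [Finset.nonempty_iff_ne_empty]
      rintro rfl
      have : j ∈ (Finset.univ : Finset (Fin k)) := Finset.mem_univ _
      rw [← hs] at this
      simp at this
    refine ⟨⟨j + 1, hlt⟩, rfl, ?_⟩
    have hcc : cnt (σ ⟨j + 1, hlt⟩) ≤ cnt (σ j) := by
      refine Finset.card_le_card fun S hS => ?_
      rw [Finset.mem_filter] at hS ⊢
      refine ⟨hS.1, fun h => ?_⟩
      obtain ⟨i, rfl⟩ := hpre S hS.1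
      rw [apply_mem_prefixSet] at h
      have h2 := hS.2
      rw [apply_mem_prefixSet] at h2
      have : i = j := by
        rw [Fin.le_def] at h h2
        simp only at h2
        exact Fin.ext (by omega)
      subst this
      exact hj hS.1
    have h2 : key (σ j) < key (σ ⟨j + 1, hlt⟩) := hmono (by rw [Fin.lt_def]; simp)
    rcases Prod.Lex.lt_iff.1 h2 with h | h
    · exact absurd h (not_lt.2 hcc)
    · exact h.2
  · ext S
    rw [mem_prefixChain]
    constructor
    · rintro ⟨j, hj, rfl⟩
      simpa using hj
    · intro hS
      obtain ⟨j, rfl⟩ := hpre S hS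
      exact ⟨j, by simpa using hS, rfl⟩

theorem chainPolynomial_univ_eq_sum :
    chainPolynomial (Finset.univ : Finset (Fin k)) =
      ∑ σ : Equiv.Perm (Fin k), X ^ descentCount σ := by
  -- Expand `X = (X - 1) + 1` once for each descent.
  have h1 : ∀ σ : Equiv.Perm (Fin k), (X : ℤ[X]) ^ descentCount σ =
      ∑ D ∈ (descentSet σ).powerset, (X - 1) ^ D.card := by
    intro σ
    have := Finset.sum_pow_mul_eq_add_pow (X - 1 : ℤ[X]) 1 (descentSet σ)
    simp only [one_pow, mul_one, sub_add_cancel] at this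
    exact this.symm
  rw [Finset.sum_congr rfl fun σ _ => h1 σ, Finset.sum_sigma', chainPolynomial]
  symm
  refine Finset.sum_bij (fun x _ => prefixChain x.1 x.2) ?_ ?_ ?_ ?_
  · rintro ⟨σ, D⟩ h
    simp only [Finset.mem_sigma, Finset.mem_powerset] at h
    exact prefixChain_mem_chainsWithTop h.2
  · rintro ⟨σ, D⟩ h ⟨σ', D'⟩ h' heq
    simp only [Finset.mem_sigma, Finset.mem_powerset] at h h'
    obtain ⟨rfl, rfl⟩ := prefixChain_injective h.2 h'.2 heq
    rfl
  · intro C hC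
    obtain ⟨σ, D, hD, h⟩ := exists_prefixChain_eq hC
    exact ⟨⟨σ, D⟩, by simpa using hD, h⟩
  · rintro ⟨σ, D⟩ h
    have := Finset.card_le_univ D
    rw [Fintype.card_fin] at this
    rw [card_prefixChain, Finset.card_fin]
    congr 1
    simp only
    omega

theorem sum_X_pow_descentCount :
    ∑ σ : Equiv.Perm (Fin k), (X : ℤ[X]) ^ descentCount σ = eulerianPolynomial k := by
  rw [eulerianPolynomial]
  split_ifs with hk
  · subst hk
    simp [descentCount]
  · have hmap : ∀ σ ∈ (Finset.univ : Finset (Equiv.Perm (Fin k))),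
        descentCount σ ∈ Finset.range k := by
      intro σ _
      rw [Finset.mem_range]
      calc descentCount σ < (Finset.univ : Finset (Fin k)).card := by
            refine Finset.card_lt_card (Finset.filter_ssubset.2
              ⟨⟨k - 1, by omega⟩, Finset.mem_univ _, ?_⟩)
            rintro ⟨j, hj, -⟩
            have := j.2
            simp only at hj
            omega
        _ = k := Finset.card_fin k
    rw [← Finset.sum_fiberwise_of_maps_to hmap]
    refine Finset.sum_congr rfl fun i _ => ?_
    rw [Finset.sum_congr rfl (g := fun _ => (X : ℤ[X]) ^ i)
      (fun σ hσ => by rw [(Finset.mem_filter.1 hσ).2]), Finset.sum_const, eulerianNumber]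
    simp

theorem chainPolynomial_eq_eulerianPolynomial {α : Type*} [DecidableEq α] [Fintype α]
    (I : Finset α) : chainPolynomial I = eulerianPolynomial I.card := by
  rw [← sum_X_pow_descentCount, ← chainPolynomial_univ_eq_sum]
  exact chainPolynomial_eq_of_card_eq I.card _ _ rfl (Finset.card_fin _)

end Eulerian

/-! ### Summation over the combinatorial data of faces -/

section FaceData

variable {m n : ℕ}

open Classical in
/-- The chains of nonempty subsets of `T` whose members other than `T` have fewer than `n`
elements. -/
noncomputable def faceChains (n : ℕ) (T : Finset (Fin m)) : Finset (Finset (Finset (Fin m))) :=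
  Finset.univ.filter fun C => IsChain (· ⊆ ·) (C : Set (Finset (Fin m))) ∧ ∅ ∉ C ∧
    (∀ S ∈ C, S ⊆ T) ∧ ∀ S ∈ C, S = T ∨ S.card < n

theorem mem_faceChains {T : Finset (Fin m)} {C : Finset (Finset (Fin m))} :
    C ∈ faceChains n T ↔ IsChain (· ⊆ ·) (C : Set (Finset (Fin m))) ∧ ∅ ∉ C ∧
      (∀ S ∈ C, S ⊆ T) ∧ ∀ S ∈ C, S = T ∨ S.card < n := by
  simp [faceChains]

theorem faceChains_empty : faceChains n (∅ : Finset (Fin m)) = {∅} := by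
  ext C
  rw [mem_faceChains, Finset.mem_singleton]
  constructor
  · rintro ⟨-, h0, hs, -⟩
    refine Finset.eq_empty_of_forall_notMem fun S hS => h0 ?_
    rwa [Finset.subset_empty.1 (hs S hS)] at hS
  · rintro rfl
    simp

theorem sum_faceChains_top_mem (hn : 1 ≤ n) {T : Finset (Fin m)} (hT : T.Nonempty)
    {M : Type*} [AddCommMonoid M] (g : Finset (Finset (Fin m)) → M) :
    ∑ C ∈ (faceChains n T).filter (T ∈ ·), g C =
      ∑ I ∈ T.ssubsets.filter (fun I => I.card < n), ∑ C ∈ chainsWithTop I, g (insert T C) := by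
  have h := sum_chains_mem_top (fun S => S.card < n) hT
    (fun S S' h h' => (Finset.card_le_card h).trans_lt h') g
  have h1 : (faceChains n T).filter (T ∈ ·) =
      (chainsWithTop T).filter (fun C => ∀ S ∈ C, S = T ∨ S.card < n) := by
    ext C
    rw [Finset.mem_filter, Finset.mem_filter, mem_faceChains, mem_chainsWithTop]
    constructor
    · rintro ⟨⟨hc, h0, hs, hp⟩, hTC⟩
      exact ⟨⟨hc, h0, le_antisymm (Finset.sup_le hs) (Finset.le_sup (f := id) hTC)⟩, hp⟩
    · rintro ⟨⟨hc, h0, hs⟩, hp⟩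
      refine ⟨⟨hc, h0, fun S hS => hs ▸ Finset.le_sup (f := id) hS, hp⟩, ?_⟩
      rw [← hs]
      refine sup_mem_of_isChain hc (Finset.nonempty_iff_ne_empty.2 ?_)
      rintro rfl
      exact hT.ne_empty (by simpa using hs.symm)
  rw [h1, h]
  refine Finset.sum_congr (Finset.filter_congr fun I _ => ?_) fun _ _ => rfl
  refine or_iff_left_of_imp ?_
  rintro rfl
  rwa [Finset.card_empty]

theorem sum_faceChains_top_notMem (hn : 1 ≤ n) {T : Finset (Fin m)} (hT : T.Nonempty)
    {M : Type*} [AddCommMonoid M] (g : Finset (Finset (Fin m)) → M) :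
    ∑ C ∈ (faceChains n T).filter (T ∉ ·), g C =
      ∑ I ∈ T.ssubsets.filter (fun I => I.card < n), ∑ C ∈ chainsWithTop I, g C := by
  rw [Finset.sum_sigma']
  refine Finset.sum_bij' (fun C _ => ⟨C.sup id, C⟩) (fun x _ => x.2) ?_ ?_ ?_ ?_ ?_
  · intro C hC
    obtain ⟨hC, hTC⟩ := Finset.mem_filter.1 hC
    obtain ⟨hc, h0, hs, hp⟩ := mem_faceChains.1 hC
    rw [Finset.mem_sigma, Finset.mem_filter, Finset.mem_ssubsets, mem_chainsWithTop]
    refine ⟨?_, hc, h0, rfl⟩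
    rcases C.eq_empty_or_nonempty with rfl | hne
    · simp only [Finset.sup_empty, Finset.bot_eq_empty, Finset.card_empty]
      exact ⟨Finset.empty_ssubset.2 hT, hn⟩
    · have hm := sup_mem_of_isChain hc hne
      have hneT : C.sup id ≠ T := fun h => hTC (h ▸ hm)
      exact ⟨lt_of_le_of_ne (hs _ hm) hneT, (hp _ hm).resolve_left hneT⟩
  · rintro ⟨I, C⟩ h
    simp only [Finset.mem_sigma, Finset.mem_filter, Finset.mem_ssubsets] at h
    obtain ⟨⟨hIT, hI⟩, hC⟩ := h
    have hsub := fun S => subset_of_mem_chainsWithTop (S := S) hC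
    obtain ⟨hc, h0, -⟩ := mem_chainsWithTop.1 hC
    rw [Finset.mem_filter, mem_faceChains]
    exact ⟨⟨hc, h0, fun S hS => (hsub S hS).trans hIT.1,
      fun S hS => Or.inr ((Finset.card_le_card (hsub S hS)).trans_lt hI)⟩,
      fun hTC => hIT.2 (hsub T hTC)⟩
  · intros
    rfl
  · rintro ⟨I, C⟩ h
    simp only [Finset.mem_sigma] at h
    obtain rfl := (mem_chainsWithTop.1 h.2).2.2
    rfl
  · intros
    rfl

/-- Chains with and without `T` pair up over the same `I`; their exponents differ by one, and `1 +
(X - 1) = X`. -/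
theorem sum_faceChains (hn : 1 ≤ n) {T : Finset (Fin m)} (hT : T.Nonempty) :
    ∑ C ∈ faceChains n T, (X - 1 : ℤ[X]) ^ (T.card - C.card) =
      ∑ I ∈ T.ssubsets.filter (fun I => I.card < n),
        eulerianPolynomial I.card * (X * (X - 1) ^ (T.card - I.card - 1)) := by
  rw [← Finset.sum_filter_add_sum_filter_not _ (T ∈ ·), sum_faceChains_top_mem hn hT,
    sum_faceChains_top_notMem hn hT, ← Finset.sum_add_distrib]
  refine Finset.sum_congr rfl fun I hI => ?_
  obtain ⟨hI, -⟩ := Finset.mem_filter.1 hI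
  have hI := Finset.mem_ssubsets.1 hI
  have h2 := Finset.card_lt_card hI
  rw [← chainPolynomial_eq_eulerianPolynomial, chainPolynomial, ← Finset.sum_add_distrib,
    Finset.sum_mul]
  refine Finset.sum_congr rfl fun C hC => ?_
  have h1 := card_le_of_mem_chainsWithTop hC
  rw [card_insert_of_mem_chainsWithTop hI hC]
  have e1 : T.card - (C.card + 1) = (I.card - C.card) + (T.card - I.card - 1) := by omega
  have e2 : T.card - C.card = (I.card - C.card) + (T.card - I.card - 1) + 1 := by omega
  rw [e1, e2, pow_succ, pow_add]
  ring

/-- Over all `T ⊇ I` the binomial theorem gives `X ^ (m - |I|)`; removing `T = I` and cancelling `X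
- 1` leaves a geometric sum. -/
theorem sum_powers_of_ssupersets (I : Finset (Fin m)) :
    X * ∑ T ∈ Finset.univ.filter (fun T => I ⊂ T), (X - 1 : ℤ[X]) ^ (T.card - I.card - 1) =
      ∑ j ∈ Finset.Icc 1 (m - I.card), X ^ j := by
  have h1 : ∑ T ∈ Finset.univ.filter (fun T => I ⊆ T), (X - 1 : ℤ[X]) ^ (T.card - I.card) =
      X ^ (m - I.card) := by
    have h := Finset.sum_pow_mul_eq_add_pow (X - 1 : ℤ[X]) 1 Iᶜ
    simp only [one_pow, mul_one, sub_add_cancel, Finset.card_compl, Fintype.card_fin] at h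
    rw [← h]
    refine Finset.sum_bij' (fun T _ => T \ I) (fun t _ => I ∪ t) ?_ ?_ ?_ ?_ ?_
    · intro T _
      rw [Finset.mem_powerset]
      intro a ha
      simpa using (Finset.mem_sdiff.1 ha).2
    · intro t _
      simp
    · intro T hT
      exact Finset.union_sdiff_of_subset (Finset.mem_filter.1 hT).2
    · intro t ht
      rw [Finset.mem_powerset] at ht
      refine Finset.union_sdiff_cancel_left ?_
      exact Finset.disjoint_left.2 fun a ha hat => Finset.mem_compl.1 (ht hat) ha
    · intro T hT
      rw [Finset.card_sdiff_of_subset (Finset.mem_filter.1 hT).2]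
  have h2 : Finset.univ.filter (fun T => I ⊆ T) =
      insert I (Finset.univ.filter (fun T => I ⊂ T)) := by
    ext T
    simp only [Finset.mem_filter, Finset.mem_univ, true_and, Finset.mem_insert]
    rw [Finset.ssubset_iff_subset_ne]
    constructor
    · intro h
      by_cases h' : T = I
      · exact Or.inl h'
      · exact Or.inr ⟨h, fun h'' => h' h''.symm⟩
    · rintro (rfl | h)
      · exact subset_rfl
      · exact h.1
  rw [h2, Finset.sum_insert (by simp), Nat.sub_self, pow_zero] at h1
  have h3 : ∑ T ∈ Finset.univ.filter (fun T => I ⊂ T), (X - 1 : ℤ[X]) ^ (T.card - I.card) =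
      (X - 1) * ∑ T ∈ Finset.univ.filter (fun T => I ⊂ T),
        (X - 1 : ℤ[X]) ^ (T.card - I.card - 1) := by
    rw [Finset.mul_sum]
    refine Finset.sum_congr rfl fun T hT => ?_
    have := Finset.card_lt_card (Finset.mem_filter.1 hT).2
    rw [← pow_succ']
    congr 1
    omega
  have h4 : (X - 1 : ℤ[X]) ≠ 0 := X_sub_C_ne_zero (1 : ℤ)
  have h5 : ∑ j ∈ Finset.Icc 1 (m - I.card), (X : ℤ[X]) ^ j =
      X * ∑ j ∈ Finset.range (m - I.card), X ^ j := by
    rw [Finset.mul_sum, ← Finset.Ico_add_one_right_eq_Icc, Finset.sum_Ico_eq_sum_range]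
    refine Finset.sum_congr (by simp) fun j _ => ?_
    rw [add_comm, pow_succ']
  rw [h5]
  congr 1
  apply mul_left_cancel₀ h4
  rw [← h3, mul_geom_sum, ← h1]
  ring

theorem sum_sum_faceChains (hn : 1 ≤ n) :
    ∑ T : Finset (Fin m), ∑ C ∈ faceChains n T, (X - 1 : ℤ[X]) ^ (T.card - C.card) =
      1 + ∑ i ∈ Finset.range n, ∑ j ∈ Finset.Icc 1 (m - i),
        C (m.choose i : ℤ) * eulerianPolynomial i * X ^ j := by
  rw [← Finset.add_sum_erase _ _ (Finset.mem_univ (∅ : Finset (Fin m))), faceChains_empty]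
  simp only [Finset.sum_singleton, Finset.card_empty, Nat.sub_self, pow_zero]
  congr 1
  rw [Finset.sum_congr rfl fun T hT => sum_faceChains hn
    (Finset.nonempty_iff_ne_empty.2 (Finset.mem_erase.1 hT).1)]
  rw [Finset.sum_comm' (t' := Finset.univ.filter (fun I : Finset (Fin m) => I.card < n))
    (s' := fun I => Finset.univ.filter (fun T => I ⊂ T))]
  · rw [Finset.sum_congr rfl fun I _ => by
      rw [← Finset.mul_sum, ← Finset.mul_sum, sum_powers_of_ssupersets]]
    have hmap : ∀ I ∈ Finset.univ.filter (fun I : Finset (Fin m) => I.card < n),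
        I.card ∈ Finset.range n := fun I hI => Finset.mem_range.2 (Finset.mem_filter.1 hI).2
    rw [← Finset.sum_fiberwise_of_maps_to hmap]
    refine Finset.sum_congr rfl fun i hi => ?_
    rw [Finset.sum_congr rfl
      (g := fun _ => eulerianPolynomial i * ∑ j ∈ Finset.Icc 1 (m - i), X ^ j)
      (fun I hI => by rw [(Finset.mem_filter.1 hI).2]), Finset.sum_const]
    have hcard : ((Finset.univ.filter (fun I : Finset (Fin m) => I.card < n)).filter
        (fun I => I.card = i)).card = m.choose i := by
      rw [← Finset.card_fin m, ← Finset.card_powersetCard, Finset.card_fin]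
      congr 1
      ext I
      simp only [Finset.mem_filter, Finset.mem_univ, true_and, Finset.mem_powersetCard,
        Finset.subset_univ]
      exact and_iff_right_of_imp fun h => h ▸ Finset.mem_range.1 hi
    rw [hcard, nsmul_eq_mul, ← mul_assoc, Finset.mul_sum]
    simp
  · intro T I
    simp only [Finset.mem_erase, Finset.mem_filter, Finset.mem_univ, and_true, true_and,
      Finset.mem_ssubsets]
    constructor
    · rintro ⟨-, h⟩
      exact h
    · rintro ⟨h1, h2⟩
      refine ⟨?_, h1, h2⟩
      rintro rfl
      exact Finset.not_ssubset_empty _ h1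

end FaceData

/-! ### Valid inequalities, vertices and recovery of the face data -/

section Geometry

variable {m n : ℕ}

/-- The sum `n + (n - 1) + ⋯` of the `k` largest values, with zeros once they are exhausted. -/
def topSum (n k : ℕ) : ℕ :=
  ∑ r ∈ Finset.range k, (n - r)

theorem topSum_of_le {k : ℕ} (h : n ≤ k) : topSum n k = topSum n n := by
  refine (Finset.sum_subset (Finset.range_mono h) fun r _ hr => ?_).symm
  rw [Finset.mem_range] at hr
  omega

/-- Induct by adding an element `a` of least value. If `w a > 0`, the values on `insert a s` are
distinct and lie in `[w a, n]`, so `w a ≤ n - |s|`. -/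
theorem sum_le_topSum {w : Fin m → ℕ} (hw : ∀ i, w i ≤ n)
    (hinj : ∀ i j, w i ≠ 0 → w i = w j → i = j) (S : Finset (Fin m)) :
    ∑ i ∈ S, w i ≤ topSum n S.card := by
  induction S using Finset.induction_on_min_value w with
  | empty => simp
  | insert a s ha hmin ih =>
    rw [Finset.sum_insert ha, Finset.card_insert_of_notMem ha, topSum, Finset.sum_range_succ,
      add_comm]
    refine add_le_add ih ?_
    rcases Nat.eq_zero_or_pos (w a) with h0 | hpos
    · omega
    · have hle : ∀ i ∈ insert a s, w a ≤ w i := by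
        intro i hi
        rcases Finset.mem_insert.1 hi with rfl | hi
        · exact le_rfl
        · exact hmin i hi
      have hc : (insert a s).card ≤ (Finset.Icc (w a) n).card := by
        refine Finset.card_le_card_of_injOn w (fun i hi => ?_) (fun i hi j hj h => ?_)
        · exact Finset.mem_coe.2 (Finset.mem_Icc.2 ⟨hle i hi, hw i⟩)
        · exact hinj i j (by have := hle i hi; omega) h
      rw [Finset.card_insert_of_notMem ha, Nat.card_Icc] at hc
      have := hw a
      omega

theorem nonneg_of_mem {x : Fin m → ℝ} (hx : x ∈ partialPermutohedron m n) (i : Fin m) :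
    0 ≤ x i := by
  have hconv : Convex ℝ {x : Fin m → ℝ | 0 ≤ x i} :=
    convex_halfSpace_ge (LinearMap.proj (R := ℝ) (φ := fun _ : Fin m => ℝ) i).isLinear 0
  refine convexHull_min ?_ hconv hx
  rintro x ⟨w, -, -, hxw⟩
  simp [hxw]

theorem sum_le_of_mem {x : Fin m → ℝ} (hx : x ∈ partialPermutohedron m n)
    (S : Finset (Fin m)) : ∑ i ∈ S, x i ≤ topSum n S.card := by
  have hconv : Convex ℝ {x : Fin m → ℝ | ∑ i ∈ S, x i ≤ topSum n S.card} :=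
    convex_halfSpace_le (f := fun x : Fin m → ℝ => ∑ i ∈ S, x i)
      ⟨fun x y => by simp [Finset.sum_add_distrib], fun c x => by simp [Finset.mul_sum]⟩ _
  refine convexHull_min ?_ hconv hx
  rintro x ⟨w, hw, hinj, hxw⟩
  have := sum_le_topSum hw hinj S
  simp only [Set.mem_ofPred_eq, hxw]
  exact_mod_cast this

/-- Once `|S| ≥ n`, enlarging `S` does not raise the bound, so no room is left for another positive
coordinate. -/
theorem eq_zero_of_sum_eq_topSum {x : Fin m → ℝ} (hx : x ∈ partialPermutohedron m n)
    {S : Finset (Fin m)} (hS : n ≤ S.card) (h : ∑ i ∈ S, x i = topSum n S.card) {i : Fin m}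
    (hi : i ∉ S) : x i = 0 := by
  have h1 := sum_le_of_mem hx (insert i S)
  rw [Finset.sum_insert hi, h, Finset.card_insert_of_notMem hi, topSum_of_le hS,
    topSum_of_le (hS.trans (Nat.le_succ _))] at h1
  have h2 := nonneg_of_mem hx i
  linarith

/-- The face of the partial permutohedron given by `T` and the chain `C`. -/
def faceOf (n : ℕ) (T : Finset (Fin m)) (C : Finset (Finset (Fin m))) : Set (Fin m → ℝ) :=
  {x | x ∈ partialPermutohedron m n ∧ (∀ i ∉ T, x i = 0) ∧
    ∀ S ∈ C, ∑ i ∈ S, x i = topSum n S.card}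

/-- The vertex with values `n, n - 1, …` in the order `ρ`, with all coordinates off `T` erased. -/
def rankVertex (n : ℕ) (ρ : Equiv.Perm (Fin m)) (T : Finset (Fin m)) (i : Fin m) : ℝ :=
  if i ∈ T then ((n - (ρ i : ℕ) : ℕ) : ℝ) else 0

theorem rankVertex_mem (ρ : Equiv.Perm (Fin m)) (T : Finset (Fin m)) :
    rankVertex n ρ T ∈ partialPermutohedron m n := by
  refine subset_convexHull ℝ _ ⟨fun i => if i ∈ T then n - (ρ i : ℕ) else 0, ?_, ?_, ?_⟩
  · intro i
    dsimp only
    split_ifs <;> omega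
  · intro i j
    dsimp only
    intro hi hij
    refine ρ.injective (Fin.ext ?_)
    split_ifs at hi hij <;> omega
  · intro i
    simp only [rankVertex]
    split_ifs <;> simp

theorem sum_rankVertex {ρ : Equiv.Perm (Fin m)} {T S : Finset (Fin m)} (hST : S ⊆ T)
    (hS : ∀ i ∈ S, (ρ i : ℕ) < S.card) : ∑ i ∈ S, rankVertex n ρ T i = topSum n S.card := by
  have hinj : Function.Injective fun i => (ρ i : ℕ) := fun i j h => ρ.injective (Fin.ext h)
  have himg : S.image (fun i => (ρ i : ℕ)) = Finset.range S.card := by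
    refine Finset.eq_of_subset_of_card_le (fun r hr => ?_) ?_
    · obtain ⟨i, hi, rfl⟩ := Finset.mem_image.1 hr
      exact Finset.mem_range.2 (hS i hi)
    · rw [Finset.card_image_of_injective _ hinj, Finset.card_range]
  rw [topSum, ← himg, Finset.sum_image fun i _ j _ h => hinj h, Nat.cast_sum]
  exact Finset.sum_congr rfl fun i hi => if_pos (hST hi)

theorem rankVertex_mem_faceOf {ρ : Equiv.Perm (Fin m)} {T T' : Finset (Fin m)}
    {C : Finset (Finset (Fin m))} (hT : T' ⊆ T) (hC : ∀ S ∈ C, S ⊆ T')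
    (hρ : ∀ S ∈ C, ∀ i ∈ S, (ρ i : ℕ) < S.card) : rankVertex n ρ T' ∈ faceOf n T C :=
  ⟨rankVertex_mem ρ T', fun _ hi => if_neg fun h => hi (hT h),
    fun S hS => sum_rankVertex (hC S hS) (hρ S hS)⟩

/-- A chain can be refined to a ranking which puts a given element first in its block. -/
theorem exists_ranking {C : Finset (Finset (Fin m))}
    (hC : IsChain (· ⊆ ·) (C : Set (Finset (Fin m)))) (a : Fin m) :
    ∃ ρ : Equiv.Perm (Fin m), (∀ S ∈ C, ∀ i ∈ S, (ρ i : ℕ) < S.card) ∧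
      ∀ b, b ≠ a → (∀ S ∈ C, b ∈ S → a ∈ S) → ρ a < ρ b := by
  let cnt : Fin m → ℕ := fun b => (C.filter (b ∉ ·)).card
  have hcnt : ∀ {S i j}, S ∈ C → i ∈ S → j ∉ S → cnt i < cnt j := by
    intro S i j hS hi hj
    refine Finset.card_lt_card (Finset.ssubset_iff_subset_ne.2 ⟨fun S' hS' => ?_, fun he => ?_⟩)
    · rw [Finset.mem_filter] at hS' ⊢
      refine ⟨hS'.1, fun hj' => ?_⟩
      rcases hC.total hS hS'.1 with h | h
      · exact hS'.2 (h hi)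
      · exact hj (h hj')
    · have : S ∈ C.filter (i ∉ ·) := he ▸ Finset.mem_filter.2 ⟨hS, hj⟩
      exact (Finset.mem_filter.1 this).2 hi
  -- The factor `2` keeps the tie-break in favour of `a` from overriding the block order.
  let key : Fin m → ℕ := fun b => 2 * cnt b + if b = a then 0 else 1
  let σ := Tuple.sort key
  have hlt : ∀ i j, key i < key j → σ.symm i < σ.symm j := by
    intro i j h
    by_contra h'
    have := Tuple.monotone_sort key (not_lt.1 h')
    simp only [Function.comp_apply] at this
    rw [show Tuple.sort key = σ from rfl, Equiv.apply_symm_apply, Equiv.apply_symm_apply] at this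
    exact not_le.2 h this
  refine ⟨σ.symm, fun S hS i hi => ?_, fun b hb hba => hlt _ _ ?_⟩
  -- Everything ranked up to `i ∈ S` lies in `S`, so `ρ i + 1 ≤ |S|`.
  · have hsub : (Finset.Iic (σ.symm i)).map σ.toEmbedding ⊆ S := by
      intro j hj
      by_contra hjS
      have hj' : σ.symm j ≤ σ.symm i := by simpa using hj
      have h1 := hcnt hS hi hjS
      refine not_lt.2 hj' (hlt _ _ ?_)
      simp only [key]
      split_ifs <;> omega
    have := Finset.card_le_card hsub
    rw [Finset.card_map, Fin.card_Iic] at this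
    omega
  · have h1 : cnt a ≤ cnt b := by
      refine Finset.card_le_card fun S hS => ?_
      rw [Finset.mem_filter] at hS ⊢
      exact ⟨hS.1, fun h => hS.2 (hba S hS.1 h)⟩
    simp only [key, if_neg hb, if_true]
    omega

/-- If `a` had rank at least `n`, its immediate predecessor would lie in a member missing `a` with
at least `n` elements; that member could only be `T`, which contains `a`. The bound makes the value
`n - ρ a` positive. -/
theorem exists_ranking_lt (hn : 1 ≤ n) {T : Finset (Fin m)} {C : Finset (Finset (Fin m))}
    (hC : C ∈ faceChains n T) {a : Fin m} (ha : a ∈ T) :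
    ∃ ρ : Equiv.Perm (Fin m), (∀ S ∈ C, ∀ i ∈ S, (ρ i : ℕ) < S.card) ∧ (ρ a : ℕ) < n ∧
      ∀ b, b ≠ a → (∀ S ∈ C, b ∈ S → a ∈ S) → ρ a < ρ b := by
  obtain ⟨hc, -, -, hp⟩ := mem_faceChains.1 hC
  obtain ⟨ρ, h1, h2⟩ := exists_ranking hc a
  refine ⟨ρ, h1, ?_, h2⟩
  by_contra hlt
  have hr : (ρ a : ℕ) - 1 < m := by
    have := (ρ a).2
    omega
  obtain ⟨b, hb⟩ := ρ.surjective ⟨(ρ a : ℕ) - 1, hr⟩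
  have hb' : (ρ b : ℕ) = (ρ a : ℕ) - 1 := congrArg Fin.val hb
  have hba : b ≠ a := by
    rintro rfl
    omega
  have h3 : ¬ ∀ S ∈ C, b ∈ S → a ∈ S := fun h => by
    have := h2 b hba h
    rw [Fin.lt_def] at this
    omega
  push Not at h3
  obtain ⟨S, hS, hbS, haS⟩ := h3
  have h4 := h1 S hS b hbS
  rcases hp S hS with rfl | h5
  · exact haS ha
  · omega

theorem faceOf_nonempty {T : Finset (Fin m)} {C : Finset (Finset (Fin m))}
    (hC : IsChain (· ⊆ ·) (C : Set (Finset (Fin m)))) (hT : ∀ S ∈ C, S ⊆ T) :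
    (faceOf n T C).Nonempty := by
  rcases Nat.eq_zero_or_pos m with rfl | hm
  · exact ⟨_, rankVertex_mem_faceOf (ρ := 1) subset_rfl hT fun _ _ i => i.elim0⟩
  · obtain ⟨ρ, hρ, -⟩ := exists_ranking hC ⟨0, hm⟩
    exact ⟨_, rankVertex_mem_faceOf subset_rfl hT hρ⟩

theorem mem_iff_exists_faceOf_ne_zero (hn : 1 ≤ n) {T : Finset (Fin m)}
    {C : Finset (Finset (Fin m))} (hC : C ∈ faceChains n T) {a : Fin m} :
    a ∈ T ↔ ∃ x ∈ faceOf n T C, x a ≠ 0 := by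
  constructor
  · intro ha
    obtain ⟨ρ, h1, h2, -⟩ := exists_ranking_lt hn hC ha
    refine ⟨_, rankVertex_mem_faceOf subset_rfl (mem_faceChains.1 hC).2.2.1 h1, ?_⟩
    rw [rankVertex, if_pos ha]
    exact_mod_cast (by omega : n - (ρ a : ℕ) ≠ 0)
  · rintro ⟨x, hx, hxa⟩
    by_contra ha
    exact hxa (hx.2.1 a ha)

theorem mem_iff_forall_faceOf_sum_eq (hn : 1 ≤ n) {T : Finset (Fin m)}
    {C : Finset (Finset (Fin m))} (hC : C ∈ faceChains n T) {S : Finset (Fin m)} :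
    S ∈ C ↔ S ⊆ T ∧ S.Nonempty ∧ ∀ x ∈ faceOf n T C, ∑ i ∈ S, x i = topSum n S.card := by
  obtain ⟨hc, h0, hsub, -⟩ := mem_faceChains.1 hC
  constructor
  · intro hS
    refine ⟨hsub S hS, Finset.nonempty_iff_ne_empty.2 ?_, fun x hx => hx.2.2 S hS⟩
    rintro rfl
    exact h0 hS
  · rintro ⟨hST, hSne, htight⟩
    -- every element of `S` lies in some member of the chain
    have hcover : ∀ a ∈ S, ∃ S' ∈ C, a ∈ S' := by
      intro a ha
      by_contra hno
      push Not at hno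
      obtain ⟨ρ, h1, h2, -⟩ := exists_ranking_lt hn hC (hST ha)
      have e1 := htight _ (rankVertex_mem_faceOf subset_rfl hsub h1)
      have e2 := htight _ (rankVertex_mem_faceOf (Finset.erase_subset a T)
        (fun S' hS' i hi => Finset.mem_erase.2
          ⟨fun h => hno S' hS' (h ▸ hi), hsub S' hS' hi⟩) h1)
      have hlt : ∑ i ∈ S, rankVertex n ρ (T.erase a) i < ∑ i ∈ S, rankVertex n ρ T i := by
        refine Finset.sum_lt_sum (fun i _ => ?_) ⟨a, ha, ?_⟩
        · simp only [rankVertex, Finset.mem_erase]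
          split_ifs with h3 h4
          · exact le_rfl
          · exact absurd h3.2 h4
          · positivity
          · exact le_rfl
        · rw [rankVertex, rankVertex, if_pos (hST ha), if_neg (by simp)]
          exact_mod_cast (by omega : 0 < n - (ρ a : ℕ))
      rw [e1, e2] at hlt
      exact lt_irrefl _ hlt
    have hC' : (C.filter (S ⊆ ·)).Nonempty := by
      obtain ⟨a, ha⟩ := hSne
      obtain ⟨S₁, hS₁, -⟩ := hcover a ha
      obtain ⟨S₂, hS₂, hmax⟩ := exists_forall_subset_of_isChain hc ⟨S₁, hS₁⟩
      refine ⟨S₂, Finset.mem_filter.2 ⟨hS₂, fun b hb => ?_⟩⟩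
      obtain ⟨S₃, hS₃, hb₃⟩ := hcover b hb
      exact hmax S₃ hS₃ hb₃
    obtain ⟨S', hS', hmin⟩ := (C.filter (S ⊆ ·)).exists_min_image Finset.card hC'
    obtain ⟨hS'C, hSS'⟩ := Finset.mem_filter.1 hS'
    by_cases hEq : S = S'
    · exact hEq ▸ hS'C
    obtain ⟨a, haS', haS⟩ := Finset.exists_of_ssubset (lt_of_le_of_ne hSS' hEq)
    -- Otherwise the largest member missing `a` would contain `S`, against the minimality of `S'`,
    -- which contains `a`.
    have hi : ∃ i ∈ S, ∀ S'' ∈ C, i ∈ S'' → a ∈ S'' := by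
      by_contra hno
      push Not at hno
      have hne : (C.filter (a ∉ ·)).Nonempty := by
        obtain ⟨i, hi⟩ := hSne
        obtain ⟨S₁, hS₁, -, h⟩ := hno i hi
        exact ⟨S₁, Finset.mem_filter.2 ⟨hS₁, h⟩⟩
      obtain ⟨S₂, hS₂, hmax⟩ := exists_forall_subset_of_isChain
        (hc.mono (Finset.coe_subset.2 (Finset.filter_subset (a ∉ ·) C))) hne
      obtain ⟨hS₂C, haS₂⟩ := Finset.mem_filter.1 hS₂
      have hSS₂ : S ⊆ S₂ := fun i hi => by
        obtain ⟨S₃, hS₃, hi₃, h⟩ := hno i hi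
        exact hmax S₃ (Finset.mem_filter.2 ⟨hS₃, h⟩) hi₃
      have hle := hmin S₂ (Finset.mem_filter.2 ⟨hS₂C, hSS₂⟩)
      rcases hc.total hS'C hS₂C with h | h
      · exact haS₂ (h haS')
      · exact haS₂ (Finset.eq_of_subset_of_card_le h hle ▸ haS')
    obtain ⟨i, hi, hia⟩ := hi
    have hne : i ≠ a := fun h => haS (h ▸ hi)
    obtain ⟨ρ, h1, h2, h3⟩ := exists_ranking_lt hn hC (hsub S' hS'C haS')
    have hlt := h3 i hne hia
    have hx := rankVertex_mem_faceOf (n := n) subset_rfl hsub h1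
    have e1 := htight _ hx
    -- Exchanging `i` for the earlier-ranked `a` strictly increases the sum at this vertex, so the
    -- sum over `S` was not maximal.
    have e2 := sum_le_of_mem hx.1 (insert a (S.erase i))
    have haS2 : a ∉ S.erase i := fun h => haS (Finset.mem_of_mem_erase h)
    rw [Finset.sum_insert haS2, Finset.card_insert_of_notMem haS2,
      Finset.card_erase_add_one hi, ← e1, ← Finset.add_sum_erase S _ hi, rankVertex, rankVertex,
      if_pos (hsub S' hS'C haS'), if_pos (hST hi)] at e2
    have e3 := (add_le_add_iff_right _).1 e2
    rw [Nat.cast_le] at e3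
    rw [Fin.lt_def] at hlt
    omega

theorem faceOf_injective (hn : 1 ≤ n) {T T' : Finset (Fin m)} {C C' : Finset (Finset (Fin m))}
    (hC : C ∈ faceChains n T) (hC' : C' ∈ faceChains n T') (h : faceOf n T C = faceOf n T' C') :
    T = T' ∧ C = C' := by
  have hT : T = T' := by
    ext a
    rw [mem_iff_exists_faceOf_ne_zero hn hC, mem_iff_exists_faceOf_ne_zero hn hC', h]
  subst hT
  refine ⟨rfl, ?_⟩
  ext S
  rw [mem_iff_forall_faceOf_sum_eq hn hC, mem_iff_forall_faceOf_sum_eq hn hC', h]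

end Geometry

/-! ### Dimension of a face -/

section Dimension

variable {m n : ℕ}

theorem finrank_eq_card_of_forall_single_mem {D : Submodule ℝ (Fin m → ℝ)} {T : Finset (Fin m)}
    (hT : ∀ v ∈ D, ∀ i ∉ T, v i = 0) (hD : ∀ a ∈ T, Pi.single a (1 : ℝ) ∈ D) :
    Module.finrank ℝ D = T.card := by
  have hspan : D = Submodule.span ℝ (Set.range fun a : T =>
      (Pi.single (a : Fin m) (1 : ℝ) : Fin m → ℝ)) := by
    refine le_antisymm (fun v hv => ?_) (Submodule.span_le.2 ?_)
    · have hsum : v = ∑ i ∈ T, v i • Pi.single i (1 : ℝ) := by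
        funext j
        rw [Finset.sum_apply]
        simp only [Pi.smul_apply, Pi.single_apply, smul_eq_mul, mul_ite, mul_one, mul_zero,
          Finset.sum_ite_eq]
        split_ifs with hj
        · rfl
        · exact hT v hv j hj
      rw [hsum]
      exact Submodule.sum_mem _ fun i hi => Submodule.smul_mem _ _
        (Submodule.subset_span ⟨⟨i, hi⟩, rfl⟩)
    · rintro _ ⟨a, rfl⟩
      exact hD a a.2
  have hind : LinearIndependent ℝ (fun a : T =>
      (Pi.single (a : Fin m) (1 : ℝ) : Fin m → ℝ)) := by
    have h := (Pi.basisFun ℝ (Fin m)).linearIndependent.comp (fun a : T => (a : Fin m))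
      Subtype.val_injective
    have he : (fun a : T => (Pi.single (a : Fin m) (1 : ℝ) : Fin m → ℝ)) =
        (Pi.basisFun ℝ (Fin m)) ∘ fun a : T => (a : Fin m) := by
      funext a
      simp
    rw [he]
    exact h
  rw [hspan, finrank_span_eq_card hind, Fintype.card_coe]

/-- The dimension of the space of vectors supported on `T` all of whose sums over members of the
chain `C` vanish; the space is given through its generators. -/
theorem finrank_add_card_chain {T : Finset (Fin m)} : ∀ (k : ℕ) (C : Finset (Finset (Fin m)))
    (D : Submodule ℝ (Fin m → ℝ)), C.card = k →
    IsChain (· ⊆ ·) (C : Set (Finset (Fin m))) → ∅ ∉ C → (∀ S ∈ C, S ⊆ T) →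
    (∀ v ∈ D, ∀ i ∉ T, v i = 0) → (∀ v ∈ D, ∀ S ∈ C, ∑ i ∈ S, v i = 0) →
    (∀ a ∈ T, ∀ b ∈ T, (∀ S ∈ C, a ∈ S ↔ b ∈ S) →
      (Pi.single a (1 : ℝ) - Pi.single b (1 : ℝ) : Fin m → ℝ) ∈ D) →
    (∀ a ∈ T, (∀ S ∈ C, a ∉ S) → Pi.single a (1 : ℝ) ∈ D) →
    Module.finrank ℝ D + C.card = T.card := by
  intro k
  induction k with
  | zero =>
    intro C D hk _ _ _ hT _ _ hfree
    rw [Finset.card_eq_zero] at hk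
    subst hk
    rw [Finset.card_empty, add_zero]
    exact finrank_eq_card_of_forall_single_mem hT fun a ha => hfree a ha (by simp)
  | succ k ih =>
    intro C D hk hc h0 hsub hT hsum hdiff hfree
    obtain ⟨S, hS, hmax⟩ := exists_forall_subset_of_isChain hc
      (Finset.card_pos.1 (by omega : 0 < C.card))
    have hce : IsChain (· ⊆ ·) ((C.erase S : Finset (Finset (Fin m))) : Set (Finset (Fin m))) :=
      hc.mono (Finset.coe_subset.2 (Finset.erase_subset _ _))
    obtain ⟨p, hpS, hp⟩ : ∃ p ∈ S, ∀ S' ∈ C.erase S, p ∉ S' := by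
      rcases (C.erase S).eq_empty_or_nonempty with he | hne
      · have hSne : S.Nonempty := by
          rw [Finset.nonempty_iff_ne_empty]
          rintro rfl
          exact h0 hS
        obtain ⟨p, hp⟩ := hSne
        exact ⟨p, hp, by simp [he]⟩
      · obtain ⟨S₁, hS₁, hmax₁⟩ := exists_forall_subset_of_isChain hce hne
        obtain ⟨h1, h2⟩ := Finset.mem_erase.1 hS₁
        obtain ⟨p, hp, hp₁⟩ := Finset.exists_of_ssubset (lt_of_le_of_ne (hmax S₁ h2) h1)
        exact ⟨p, hp, fun S' hS' h => hp₁ (hmax₁ S' hS' h)⟩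
    have hpD : (Pi.single p (1 : ℝ) : Fin m → ℝ) ∉ D := fun h => by
      have := hsum _ h S hS
      rw [Finset.sum_pi_single', if_pos hpS] at this
      exact one_ne_zero this
    -- Dropping the top member `S` frees one direction: `p` lies in `S` but in no smaller member, so
    -- adjoining its unit vector gives generators for the shorter chain.
    let D' := D ⊔ Submodule.span ℝ {(Pi.single p (1 : ℝ) : Fin m → ℝ)}
    have hDD' : D ≤ D' := le_sup_left
    have hpD' : (Pi.single p (1 : ℝ) : Fin m → ℝ) ∈ D' :=
      (le_sup_right : _ ≤ D') (Submodule.mem_span_singleton_self _)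
    have hmem : ∀ v ∈ D', ∃ d ∈ D, ∃ c : ℝ, v = d + c • Pi.single p (1 : ℝ) := by
      intro v hv
      obtain ⟨d, hd, y, hy, rfl⟩ := Submodule.mem_sup.1 hv
      obtain ⟨c, rfl⟩ := Submodule.mem_span_singleton.1 hy
      exact ⟨d, hd, c, rfl⟩
    have hfree' : ∀ a ∈ T, (∀ S' ∈ C.erase S, a ∉ S') → (Pi.single a (1 : ℝ) : Fin m → ℝ) ∈ D' := by
      intro a ha hfa
      by_cases haS : a ∈ S
      · have h1 := hDD' (hdiff a ha p (hsub S hS hpS) fun S' hS' => by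
          by_cases h : S' = S
          · subst h
            exact ⟨fun _ => hpS, fun _ => haS⟩
          · have h' := Finset.mem_erase.2 ⟨h, hS'⟩
            exact ⟨fun h => absurd h (hfa S' h'), fun h => absurd h (hp S' h')⟩)
        have := D'.add_mem h1 hpD'
        rwa [sub_add_cancel] at this
      · exact hDD' (hfree a ha fun S' hS' h => haS (hmax S' hS' h))
    have hcard : (C.erase S).card = k := by
      rw [Finset.card_erase_of_mem hS, hk, Nat.add_sub_cancel]
    have hfin := ih (C.erase S) D' hcard hce (fun h => h0 (Finset.mem_of_mem_erase h))
      (fun S' hS' => hsub S' (Finset.mem_of_mem_erase hS'))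
      (fun v hv i hi => by
        obtain ⟨d, hd, c, rfl⟩ := hmem v hv
        have hip : i ≠ p := fun h => hi (h ▸ hsub S hS hpS)
        simp [hT d hd i hi, Pi.single_eq_of_ne hip])
      (fun v hv S' hS' => by
        obtain ⟨d, hd, c, rfl⟩ := hmem v hv
        have h1 := hsum d hd S' (Finset.mem_of_mem_erase hS')
        simp only [Pi.add_apply, Pi.smul_apply, Finset.sum_add_distrib, ← Finset.smul_sum, h1]
        rw [Finset.sum_pi_single', if_neg (hp S' hS')]
        simp)
      (fun a ha b hb hab => by
        by_cases h : a ∈ S ↔ b ∈ S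
        · refine hDD' (hdiff a ha b hb fun S' hS' => ?_)
          by_cases h' : S' = S
          · exact h' ▸ h
          · exact hab S' (Finset.mem_erase.2 ⟨h', hS'⟩)
        -- Exactly one of `a`, `b` lies in `S`; the other is in no member, so by `hab` neither is in
        -- a member below `S`.
        · have hnot : ∀ S' ∈ C.erase S, a ∉ S' ∧ b ∉ S' := by
            intro S' hS'
            have h1 := hab S' hS'
            have h2 : S' ⊆ S := hmax S' (Finset.mem_of_mem_erase hS')
            by_contra h3
            refine h ⟨fun _ => h2 ?_, fun _ => h2 ?_⟩ <;> tauto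
          exact D'.sub_mem (hfree' a ha fun S' hS' => (hnot S' hS').1)
            (hfree' b hb fun S' hS' => (hnot S' hS').2))
      hfree'
    have hrank : Module.finrank ℝ D' = Module.finrank ℝ D + 1 :=
      Submodule.finrank_sup_span_singleton hpD
    rw [hrank, hcard] at hfin
    omega

theorem vectorSpan_le_ker {F : Set (Fin m → ℝ)} {ℓ : (Fin m → ℝ) →ₗ[ℝ] ℝ} {c : ℝ}
    (h : ∀ x ∈ F, ℓ x = c) {v : Fin m → ℝ} (hv : v ∈ vectorSpan ℝ F) : ℓ v = 0 := by
  have hle : vectorSpan ℝ F ≤ LinearMap.ker ℓ := by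
    refine Submodule.span_le.2 ?_
    rintro _ ⟨x, hx, y, hy, rfl⟩
    simp [h x hx, h y hy]
  exact LinearMap.mem_ker.1 (hle hv)

/-- Differences of two vertices supply the generators: swapping `a` and `b` in one block gives a
multiple of `e_a - e_b`, and erasing an `a` outside all members gives a multiple of `e_a`. -/
theorem dimension_faceOf_add_card (hn : 1 ≤ n) {T : Finset (Fin m)} {C : Finset (Finset (Fin m))}
    (hC : C ∈ faceChains n T) : dimension (faceOf n T C) + C.card = T.card := by
  obtain ⟨hc, h0, hsub, -⟩ := mem_faceChains.1 hC
  refine finrank_add_card_chain _ C _ rfl hc h0 hsub ?_ ?_ ?_ ?_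
  · intro v hv i hi
    exact vectorSpan_le_ker (ℓ := LinearMap.proj i) (c := 0) (fun x hx => hx.2.1 i hi) hv
  · intro v hv S hS
    have := vectorSpan_le_ker (ℓ := ∑ i ∈ S, LinearMap.proj i) (c := topSum n S.card)
      (fun x hx => by simpa using hx.2.2 S hS) hv
    simpa using this
  · intro a ha b hb hab
    by_cases h : b = a
    · subst h
      simp
    obtain ⟨ρ, h1, h2, h3⟩ := exists_ranking_lt hn hC ha
    have hlt := h3 b h fun S hS hbS => (hab S hS).2 hbS
    have hx := rankVertex_mem_faceOf (n := n) subset_rfl hsub h1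
    have hx' := rankVertex_mem_faceOf (n := n) (ρ := (Equiv.swap a b).trans ρ) subset_rfl hsub
      (fun S hS i hi => h1 S hS _ (by
        rcases eq_or_ne i a with rfl | hia
        · rw [Equiv.swap_apply_left]
          exact (hab S hS).1 hi
        · rcases eq_or_ne i b with rfl | hib
          · rw [Equiv.swap_apply_right]
            exact (hab S hS).2 hi
          · rwa [Equiv.swap_apply_of_ne_of_ne hia hib]))
    have hsubv := vsub_mem_vectorSpan ℝ hx hx'
    have hne : ((n - (ρ a : ℕ) : ℕ) : ℝ) - ((n - (ρ b : ℕ) : ℕ) : ℝ) ≠ 0 := by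
      rw [Fin.lt_def] at hlt
      exact sub_ne_zero.2 (by exact_mod_cast (by omega : n - (ρ a : ℕ) ≠ n - (ρ b : ℕ)))
    have heq : rankVertex n ρ T -ᵥ rankVertex n ((Equiv.swap a b).trans ρ) T =
        (((n - (ρ a : ℕ) : ℕ) : ℝ) - ((n - (ρ b : ℕ) : ℕ) : ℝ)) •
          (Pi.single a (1 : ℝ) - Pi.single b (1 : ℝ) : Fin m → ℝ) := by
      funext i
      simp only [vsub_eq_sub, Pi.sub_apply, Pi.smul_apply, smul_eq_mul, rankVertex,
        Equiv.trans_apply]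
      rcases eq_or_ne i a with rfl | hia
      · rw [Equiv.swap_apply_left, if_pos ha, if_pos ha, Pi.single_eq_same,
          Pi.single_eq_of_ne (Ne.symm h)]
        ring
      · rcases eq_or_ne i b with rfl | hib
        · rw [Equiv.swap_apply_right, if_pos hb, if_pos hb, Pi.single_eq_same,
            Pi.single_eq_of_ne h]
          ring
        · rw [Equiv.swap_apply_of_ne_of_ne hia hib, Pi.single_eq_of_ne hia,
            Pi.single_eq_of_ne hib]
          ring
    rw [heq] at hsubv
    exact (Submodule.smul_mem_iff _ hne).1 hsubv
  · intro a ha hfree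
    obtain ⟨ρ, h1, h2, -⟩ := exists_ranking_lt hn hC ha
    have hx := rankVertex_mem_faceOf (n := n) subset_rfl hsub h1
    have hx' := rankVertex_mem_faceOf (n := n) (Finset.erase_subset a T)
      (fun S hS i hi => Finset.mem_erase.2 ⟨fun h => hfree S hS (h ▸ hi), hsub S hS hi⟩) h1
    have hsubv := vsub_mem_vectorSpan ℝ hx hx'
    have hne : ((n - (ρ a : ℕ) : ℕ) : ℝ) ≠ 0 := by
      exact_mod_cast (by omega : n - (ρ a : ℕ) ≠ 0)
    have heq : rankVertex n ρ T -ᵥ rankVertex n ρ (T.erase a) =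
        ((n - (ρ a : ℕ) : ℕ) : ℝ) • (Pi.single a (1 : ℝ) : Fin m → ℝ) := by
      funext i
      simp only [vsub_eq_sub, Pi.sub_apply, Pi.smul_apply, smul_eq_mul, rankVertex,
        Finset.mem_erase]
      rcases eq_or_ne i a with rfl | hia
      · simp [ha]
      · simp [hia]
    rw [heq] at hsubv
    exact (Submodule.smul_mem_iff _ hne).1 hsubv

end Dimension

/-! ### Every nonempty face comes from a chain -/

section Faces

variable {m n : ℕ}

/-- A linear functional whose negative part is a combination of indicators of a chain, and the face
on which it is minimal. -/
theorem functional_faceOf {T : Finset (Fin m)} {C : Finset (Finset (Fin m))} {a μ : Fin m → ℝ}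
    {w : Finset (Fin m) → ℝ} (hw : ∀ S ∈ C, 0 < w S) (hμ : ∀ i ∈ T, μ i = 0)
    (hμ' : ∀ i ∉ T, 0 < μ i) (ha : ∀ i, a i = μ i - ∑ S ∈ C, if i ∈ S then w S else 0)
    {x : Fin m → ℝ} (hx : x ∈ partialPermutohedron m n) :
    -∑ S ∈ C, w S * topSum n S.card ≤ dotProduct a x ∧
      (dotProduct a x = -∑ S ∈ C, w S * topSum n S.card ↔ x ∈ faceOf n T C) := by
  -- The functional exceeds its claimed minimum by a positive combination of slacks, so equality
  -- forces each of these slacks to vanish.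
  have hsum : dotProduct a x + ∑ S ∈ C, w S * topSum n S.card =
      ∑ i, μ i * x i + ∑ S ∈ C, w S * (topSum n S.card - ∑ i ∈ S, x i) := by
    have h1 : ∑ i, (∑ S ∈ C, if i ∈ S then w S else 0) * x i = ∑ S ∈ C, w S * ∑ i ∈ S, x i := by
      simp only [Finset.sum_mul, Finset.mul_sum]
      rw [Finset.sum_comm]
      refine Finset.sum_congr rfl fun S _ => ?_
      simp only [ite_mul, zero_mul]
      rw [Finset.sum_ite_mem, Finset.univ_inter]
    simp only [dotProduct, ha, sub_mul, Finset.sum_sub_distrib, h1, mul_sub]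
    ring
  have hμ0 : ∀ i, 0 ≤ μ i := fun i => by
    by_cases hi : i ∈ T
    · exact (hμ i hi).ge
    · exact (hμ' i hi).le
  have hp1 : ∀ i ∈ Finset.univ, 0 ≤ μ i * x i := fun i _ => mul_nonneg (hμ0 i) (nonneg_of_mem hx i)
  have hp2 : ∀ S ∈ C, 0 ≤ w S * (topSum n S.card - ∑ i ∈ S, x i) := fun S hS =>
    mul_nonneg (hw S hS).le (sub_nonneg.2 (sum_le_of_mem hx S))
  have hs1 := Finset.sum_nonneg hp1
  have hs2 := Finset.sum_nonneg hp2
  refine ⟨by linarith, ?_⟩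
  constructor
  · intro h
    have e1 : ∑ i, μ i * x i = 0 := by linarith
    have e2 : ∑ S ∈ C, w S * (topSum n S.card - ∑ i ∈ S, x i) = 0 := by linarith
    rw [Finset.sum_eq_zero_iff_of_nonneg hp1] at e1
    rw [Finset.sum_eq_zero_iff_of_nonneg hp2] at e2
    refine ⟨hx, fun i hi => ?_, fun S hS => ?_⟩
    · exact (mul_eq_zero.1 (e1 i (Finset.mem_univ i))).resolve_left (hμ' i hi).ne'
    · have := (mul_eq_zero.1 (e2 S hS)).resolve_left (hw S hS).ne'
      linarith
  · rintro ⟨-, h1, h2⟩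
    have e1 : ∑ i, μ i * x i = 0 := Finset.sum_eq_zero fun i _ => by
      by_cases hi : i ∈ T
      · rw [hμ i hi, zero_mul]
      · rw [h1 i hi, mul_zero]
    have e2 : ∑ S ∈ C, w S * (topSum n S.card - ∑ i ∈ S, x i) = 0 :=
      Finset.sum_eq_zero fun S hS => by rw [h2 S hS, sub_self, mul_zero]
    linarith

theorem isFace_faceOf (T : Finset (Fin m)) (C : Finset (Finset (Fin m))) :
    IsFace (partialPermutohedron m n) (faceOf n T C) := by
  have h := fun x hx => functional_faceOf (n := n) (x := x) (T := T) (C := C)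
    (a := fun i => (if i ∈ T then (0 : ℝ) else 1) - ∑ S ∈ C, if i ∈ S then (1 : ℝ) else 0)
    (w := fun _ => 1) (fun _ _ => one_pos) (fun i hi => if_pos hi)
    (fun i hi => by rw [if_neg hi]; exact one_pos) (fun _ => rfl) hx
  refine ⟨_, _, fun x hx => (h x hx).1, ?_⟩
  ext x
  exact ⟨fun hx => ⟨hx.1, (h x hx.1).2.2 hx⟩, fun hx => (h x hx.1).2.1 hx.2⟩

/-- A nonnegative vector is a positive combination of indicators of a chain. -/
theorem exists_chain_decomposition : ∀ (k : ℕ) (c : Fin m → ℝ), (∀ i, 0 ≤ c i) →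
    (Finset.univ.filter fun i => 0 < c i).card = k →
    ∃ (C : Finset (Finset (Fin m))) (w : Finset (Fin m) → ℝ),
      IsChain (· ⊆ ·) (C : Set (Finset (Fin m))) ∧ ∅ ∉ C ∧ (∀ S ∈ C, 0 < w S) ∧
      (∀ S ∈ C, ∀ i ∈ S, 0 < c i) ∧ ∀ i, c i = ∑ S ∈ C, if i ∈ S then w S else 0 := by
  intro k
  induction k using Nat.strong_induction_on with
  | _ k ih =>
    intro c hc hk
    set U := Finset.univ.filter fun i => 0 < c i with hU
    have hmemU : ∀ i, i ∈ U ↔ 0 < c i := fun i => by simp [hU]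
    rcases U.eq_empty_or_nonempty with he | hne
    · refine ⟨∅, fun _ => 0, by simp, by simp, by simp, by simp, fun i => ?_⟩
      rw [Finset.sum_empty]
      refine le_antisymm (not_lt.1 fun h => ?_) (hc i)
      have := (hmemU i).2 h
      simp [he] at this
    · obtain ⟨p, hp, hmin⟩ := U.exists_min_image c hne
      have hpos := (hmemU p).1 hp
      -- Peel off the least positive value on the support `U`; `p` leaves the support, so all later
      -- sets are proper subsets of `U`.
      let c' : Fin m → ℝ := fun i => c i - if i ∈ U then c p else 0
      have hc' : ∀ i, 0 ≤ c' i := fun i => by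
        simp only [c']
        split_ifs with hi
        · exact sub_nonneg.2 (hmin i hi)
        · simpa using hc i
      have hsub : ∀ i, 0 < c' i → i ∈ U.erase p := by
        intro i hi
        have hiU : i ∈ U := by
          by_contra hiU
          simp only [c', if_neg hiU, sub_zero] at hi
          exact hiU ((hmemU i).2 hi)
        refine Finset.mem_erase.2 ⟨?_, hiU⟩
        rintro rfl
        simp [c', hiU] at hi
      have hlt : (Finset.univ.filter fun i => 0 < c' i).card < k := by
        rw [← hk]
        refine (Finset.card_le_card fun i hi => hsub i (Finset.mem_filter.1 hi).2).trans_lt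
          (Finset.card_erase_lt_of_mem hp)
      obtain ⟨C, w, h1, h2, h3, h4, h5⟩ := ih _ hlt c' hc' rfl
      have hCU : ∀ S ∈ C, S ⊆ U.erase p := fun S hS i hi => hsub i (h4 S hS i hi)
      have hUC : U ∉ C := fun h => Finset.notMem_erase p U (hCU U h hp)
      refine ⟨insert U C, Function.update w U (c p), ?_, ?_, ?_, ?_, ?_⟩
      · rw [Finset.coe_insert]
        exact h1.insert fun S hS _ => Or.inr ((hCU S hS).trans (Finset.erase_subset _ _))
      · rw [Finset.mem_insert, not_or]
        exact ⟨hne.ne_empty.symm, h2⟩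
      · intro S hS
        rcases Finset.mem_insert.1 hS with rfl | hS
        · rwa [Function.update_self]
        · rw [Function.update_of_ne (ne_of_mem_of_not_mem hS hUC)]
          exact h3 S hS
      · intro S hS i hi
        rcases Finset.mem_insert.1 hS with rfl | hS
        · exact (hmemU i).1 hi
        · exact (hmemU i).1 (Finset.mem_of_mem_erase (hCU S hS hi))
      · intro i
        rw [Finset.sum_insert hUC, Function.update_self]
        have h6 : ∑ S ∈ C, (if i ∈ S then Function.update w U (c p) S else 0) = c' i := by
          rw [h5]
          refine Finset.sum_congr rfl fun S hS => ?_
          rw [Function.update_of_ne (ne_of_mem_of_not_mem hS hUC)]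
        rw [h6]
        simp only [c']
        ring

/-- Members with at least `n` elements other than the smallest such one are redundant. -/
theorem exists_faceChains_faceOf_eq {T : Finset (Fin m)} {C : Finset (Finset (Fin m))}
    (hc : IsChain (· ⊆ ·) (C : Set (Finset (Fin m)))) (h0 : ∅ ∉ C) (hsub : ∀ S ∈ C, S ⊆ T) :
    ∃ T', ∃ C' ∈ faceChains n T', faceOf n T C = faceOf n T' C' := by
  by_cases hbig : (C.filter fun S => n ≤ S.card).Nonempty
  · obtain ⟨R, hR, hmin⟩ := (C.filter fun S => n ≤ S.card).exists_min_image Finset.card hbig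
    obtain ⟨hRC, hnR⟩ := Finset.mem_filter.1 hR
    have hsmall : ∀ S ∈ C, S.card < n → S ⊆ R := fun S hS hlt => by
      rcases hc.total hS hRC with h | h
      · exact h
      · have := Finset.card_le_card h
        omega
    have hCsub : insert R (C.filter fun S => S.card < n) ⊆ C :=
      Finset.insert_subset hRC (Finset.filter_subset _ _)
    refine ⟨R, insert R (C.filter fun S => S.card < n), ?_, ?_⟩
    · rw [mem_faceChains]
      refine ⟨hc.mono (Finset.coe_subset.2 hCsub), fun h => h0 (hCsub h), ?_, ?_⟩
      · intro S hS
        rcases Finset.mem_insert.1 hS with rfl | hS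
        · exact subset_rfl
        · exact hsmall S (Finset.mem_filter.1 hS).1 (Finset.mem_filter.1 hS).2
      · intro S hS
        rcases Finset.mem_insert.1 hS with h | h
        · exact Or.inl h
        · exact Or.inr (Finset.mem_filter.1 h).2
    · ext x
      constructor
      · rintro ⟨hx, -, h2⟩
        -- Tightness on `R` already kills the coordinates off `R`, so `R` can take the place of `T`
        -- and every larger member becomes redundant.
        exact ⟨hx, fun i hi => eq_zero_of_sum_eq_topSum hx hnR (h2 R hRC) hi,
          fun S hS => h2 S (hCsub hS)⟩
      · rintro ⟨hx, h1, h2⟩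
        refine ⟨hx, fun i hi => h1 i fun h => hi (hsub R hRC h), fun S hS => ?_⟩
        by_cases hlt : S.card < n
        · exact h2 S (Finset.mem_insert_of_mem (Finset.mem_filter.2 ⟨hS, hlt⟩))
        · have hle := hmin S (Finset.mem_filter.2 ⟨hS, not_lt.1 hlt⟩)
          have hRS : R ⊆ S := by
            rcases hc.total hRC hS with h | h
            · exact h
            · exact (Finset.eq_of_subset_of_card_le h hle).ge
          rw [← Finset.sum_subset hRS fun i _ hi => h1 i hi, h2 R (Finset.mem_insert_self _ _),
            topSum_of_le hnR, topSum_of_le (not_lt.1 hlt)]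
  · refine ⟨T, C, mem_faceChains.2 ⟨hc, h0, hsub, fun S hS => Or.inr ?_⟩, rfl⟩
    by_contra h
    exact hbig ⟨S, Finset.mem_filter.2 ⟨hS, not_lt.1 h⟩⟩

theorem exists_faceOf_eq_of_isFace {F : Set (Fin m → ℝ)}
    (hF : IsFace (partialPermutohedron m n) F) (hne : F.Nonempty) :
    ∃ T, ∃ C ∈ faceChains n T, F = faceOf n T C := by
  obtain ⟨a, b, hb, rfl⟩ := hF
  obtain ⟨C, w, hc, h0, hw, hpos, hsum⟩ :=
    exists_chain_decomposition _ (fun i => max (-a i) 0) (fun i => le_max_right _ _) rfl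
  -- Coordinates with `a i = 0` belong to `T`, since the functional does not constrain them.
  let T : Finset (Fin m) := Finset.univ.filter fun i => a i ≤ 0
  have hT : ∀ i, i ∈ T ↔ a i ≤ 0 := fun i => by simp [T]
  have hsub : ∀ S ∈ C, S ⊆ T := by
    intro S hS i hi
    have := hpos S hS i hi
    rw [lt_max_iff] at this
    exact (hT i).2 (by rcases this with h | h <;> linarith)
  have key := fun x hx => functional_faceOf (n := n) (x := x) (T := T) (C := C) (a := a)
    (μ := fun i => max (a i) 0) (w := w) hw (fun i hi => max_eq_right ((hT i).1 hi))
    (fun i hi => lt_max_of_lt_left (not_le.1 fun h => hi ((hT i).2 h)))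
    (fun i => by
      rw [← hsum i]
      rcases le_total (a i) 0 with h | h
      · rw [max_eq_right h, max_eq_left (by linarith)]
        ring
      · rw [max_eq_left h, max_eq_right (by linarith)]
        ring) hx
  obtain ⟨x, hx⟩ := faceOf_nonempty (n := n) hc hsub
  obtain ⟨y, hy, hyb⟩ := hne
  have h1 := hb x hx.1
  rw [(key x hx.1).2.2 hx] at h1
  have h2 := (key y hy).1
  rw [hyb] at h2
  -- As the face is nonempty, `b` is the actual minimum of the functional.
  have hbeq := le_antisymm h1 h2
  obtain ⟨T', C', hC', heq⟩ := exists_faceChains_faceOf_eq (n := n) hc h0 hsub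
  refine ⟨T', C', hC', heq ▸ ?_⟩
  ext z
  constructor
  · rintro ⟨hz, hzb⟩
    exact (key z hz).2.1 (hzb.trans hbeq)
  · intro hz
    exact ⟨hz.1, ((key z hz.1).2.2 hz).trans hbeq.symm⟩

end Faces

/-! ### The h-polynomial and the recurrence -/

section HPolynomial

variable {m n : ℕ}

theorem faceCount_eq_card (hn : 1 ≤ n) (i : ℕ) :
    faceCount (partialPermutohedron m n) i =
      (((Finset.univ : Finset (Finset (Fin m))).sigma (faceChains n)).filter
        fun d => d.1.card - d.2.card = i).card := by
  rw [faceCount]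
  have hinj : Set.InjOn (fun d : (_ : Finset (Fin m)) × Finset (Finset (Fin m)) =>
      faceOf n d.1 d.2) ((((Finset.univ : Finset (Finset (Fin m))).sigma (faceChains n)).filter
        fun d => d.1.card - d.2.card = i) : Finset _) := by
    rintro ⟨T, C⟩ h ⟨T', C'⟩ h' heq
    simp only [Finset.coe_filter, Finset.mem_sigma, Set.mem_ofPred_eq] at h h'
    obtain ⟨rfl, rfl⟩ := faceOf_injective hn h.1.2 h'.1.2 heq
    rfl
  rw [← Set.ncard_coe_finset, ← hinj.ncard_image]
  congr 1
  ext F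
  simp only [Set.mem_ofPred_eq, Set.mem_image, Finset.mem_coe, Finset.mem_filter,
    Finset.mem_sigma, Finset.mem_univ, true_and]
  constructor
  · rintro ⟨hF, hne, hdim⟩
    obtain ⟨T, C, hC, rfl⟩ := exists_faceOf_eq_of_isFace hF hne
    refine ⟨⟨T, C⟩, ⟨hC, ?_⟩, rfl⟩
    have := dimension_faceOf_add_card hn hC
    change T.card - C.card = i
    omega
  · rintro ⟨⟨T, C⟩, ⟨hC, hi⟩, rfl⟩
    obtain ⟨hc, -, hsub, -⟩ := mem_faceChains.1 hC
    refine ⟨isFace_faceOf T C, faceOf_nonempty hc hsub, ?_⟩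
    have : dimension (faceOf n T C) + C.card = T.card := dimension_faceOf_add_card hn hC
    change T.card - C.card = i at hi
    change dimension (faceOf n T C) = i
    omega

theorem dimension_partialPermutohedron (hn : 1 ≤ n) :
    dimension (partialPermutohedron m n) = m := by
  have h : partialPermutohedron m n = faceOf n Finset.univ ∅ := by
    ext x
    simp [faceOf]
  have hC : (∅ : Finset (Finset (Fin m))) ∈ faceChains n Finset.univ := by
    simp [mem_faceChains]
  have := dimension_faceOf_add_card hn hC
  rw [Finset.card_empty, Finset.card_fin, add_zero] at this
  rw [h, this]

theorem hPolynomial_partialPermutohedron (hn : 1 ≤ n) :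
    hPolynomial (partialPermutohedron m n) =
      1 + ∑ i ∈ Finset.range n, ∑ j ∈ Finset.Icc 1 (m - i),
        C (m.choose i : ℤ) * eulerianPolynomial i * X ^ j := by
  rw [← sum_sum_faceChains hn, hPolynomial, fPolynomial, dimension_partialPermutohedron hn,
    Finset.sum_sigma']
  have hmap : ∀ d ∈ (Finset.univ : Finset (Finset (Fin m))).sigma (faceChains n),
      d.1.card - d.2.card ∈ Finset.range (m + 1) := by
    rintro ⟨T, D⟩ -
    have := Finset.card_le_univ T
    rw [Fintype.card_fin] at this
    rw [Finset.mem_range]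
    simp only
    omega
  rw [← Finset.sum_fiberwise_of_maps_to hmap, ← coe_compRingHom_apply, map_sum]
  refine Finset.sum_congr rfl fun i _ => ?_
  rw [Finset.sum_congr rfl (g := fun _ => (X - 1 : ℤ[X]) ^ i)
    (fun d hd => by rw [(Finset.mem_filter.1 hd).2]), Finset.sum_const, faceCount_eq_card hn]
  simp

/-- The recurrence adds exactly the summand `i = n` of the closed formula; at `n = 1` only `i = 0`
is present, and `A 0 = 1` turns it into the geometric sum. -/
theorem closed_formula_iff_recurrence (m : ℕ) (A : ℕ → ℤ[X]) (hA : A 0 = 1) (H : ℕ → ℤ[X]) :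
    (∀ n : ℕ, 1 ≤ n → H n = 1 + ∑ i ∈ Finset.range n, ∑ j ∈ Finset.Icc 1 (m - i),
        C (m.choose i : ℤ) * A i * X ^ j) ↔
      (H 1 = ∑ i ∈ Finset.range (m + 1), X ^ i ∧
        ∀ n : ℕ, 1 ≤ n → H (n + 1) = H n + C (m.choose n : ℤ) * A n *
          ∑ i ∈ Finset.Icc 1 (m - n), X ^ i) := by
  have h1 : (1 : ℤ[X]) + ∑ i ∈ Finset.range 1, ∑ j ∈ Finset.Icc 1 (m - i),
      C (m.choose i : ℤ) * A i * X ^ j = ∑ i ∈ Finset.range (m + 1), X ^ i := by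
    rw [Finset.sum_range_one, hA, Finset.sum_range_succ', pow_zero, add_comm,
      ← Finset.Ico_add_one_right_eq_Icc, Finset.sum_Ico_eq_sum_range]
    simp [add_comm]
  constructor
  · intro h
    refine ⟨by rw [h 1 le_rfl, h1], fun n hn => ?_⟩
    rw [h n hn, h (n + 1) (by omega), Finset.sum_range_succ, Finset.mul_sum, add_assoc]
  · rintro ⟨h, hrec⟩ n hn
    induction n, hn using Nat.le_induction with
    | base => rw [h, h1]
    | succ n hn ih => rw [hrec n hn, ih, Finset.sum_range_succ, Finset.mul_sum, add_assoc]

end HPolynomial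

end PartialPermutohedron

theorem mainTheorem2 (m : ℕ) (hm : 1 ≤ m) :
    -- the closed formula
    (∀ n : ℕ, 1 ≤ n →
      PartialPermutohedron.hPolynomial (PartialPermutohedron.partialPermutohedron m n) =
        1 + ∑ i ∈ Finset.range n, ∑ j ∈ Finset.Icc 1 (m - i),
          C (m.choose i : ℤ) * PartialPermutohedron.eulerianPolynomial i * X ^ j) ∧
    -- the initial condition
    PartialPermutohedron.hPolynomial (PartialPermutohedron.partialPermutohedron m 1) =
      ∑ i ∈ Finset.range (m + 1), X ^ i ∧
    -- the recurrence relation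
    (∀ n : ℕ, 1 ≤ n →
      PartialPermutohedron.hPolynomial (PartialPermutohedron.partialPermutohedron m (n + 1)) =
        PartialPermutohedron.hPolynomial (PartialPermutohedron.partialPermutohedron m n) +
          C (m.choose n : ℤ) * PartialPermutohedron.eulerianPolynomial n *
            ∑ i ∈ Finset.Icc 1 (m - n), X ^ i) ∧
    -- the closed formula is equivalent to the recurrence with the initial condition
    (∀ H : ℕ → ℤ[X],
      (∀ n : ℕ, 1 ≤ n →
        H n = 1 + ∑ i ∈ Finset.range n, ∑ j ∈ Finset.Icc 1 (m - i),
          C (m.choose i : ℤ) * PartialPermutohedron.eulerianPolynomial i * X ^ j) ↔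
      (H 1 = ∑ i ∈ Finset.range (m + 1), X ^ i ∧
        ∀ n : ℕ, 1 ≤ n →
          H (n + 1) = H n + C (m.choose n : ℤ) * PartialPermutohedron.eulerianPolynomial n *
            ∑ i ∈ Finset.Icc 1 (m - n), X ^ i)) := by
  have hiff := PartialPermutohedron.closed_formula_iff_recurrence m
    PartialPermutohedron.eulerianPolynomial (by simp [PartialPermutohedron.eulerianPolynomial])
  have hclosed := fun n (hn : 1 ≤ n) =>
    PartialPermutohedron.hPolynomial_partialPermutohedron (m := m) hn
  have hrec := (hiff fun n => PartialPermutohedron.hPolynomial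
    (PartialPermutohedron.partialPermutohedron m n)).1 hclosed
  exact ⟨hclosed, hrec.1, hrec.2, hiff⟩
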